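/- Let $X$ be a random vector in $\mathbb{R}^d$ with a probability density $p_X$ with respect to the Lebesgue measure which has a locally integrable weak gradient $\nabla p_X$ (for instance $p_X\in\mathcal C^1$), and write $\nabla\log p_X=\nabla p_X/p_X$, which is defined almost surely under the law of $X$. Let $\sigma>0$ and $Y=X+\varepsilon$, where $\varepsilon\sim\mathcal N(0,\sigma^2 I)$ is independent of $X$; let $p_Y$ be the continuous (in fact smooth and positive) density of $Y$, and for $\alpha\in\mathbb{R}$ put $\varphi_\alpha(y)=y+\alpha\sigma^2\nabla\log p_Y(y)$. Let $k(x,y)=\psi(x-y)$ be a translation-invariant kernel on $\mathbb{R}^d$, where $\psi:\mathbb{R}^d\to\mathbb{R}$ is a bounded, continuous, positive definite function with spectral measure $\Lambda$, i.e. $\Lambda$ is the finite nonnegative Borel measure on $\mathbb{R}^d$ such that $\psi(x)=\int e^{-i\xi\cdot x}\,d\Lambda(\xi)$ for all $x$. Let $\mathcal H$ be the reproducing kernel Hilbert space of $k$ and let $$\mathrm{MMD}_k(\mathcal L(Z_1),\mathcal L(Z_2))=\sup_{f\in\mathcal H,\ \|f\|_{\mathcal H}\le 1}\big(\mathbb{E}[f(Z_1)]-\mathbb{E}[f(Z_2)]\big).$$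 Assume that $\mathbb{E}[\|\nabla\log p_X(X)\|^2]\le C$ and that $$C_2=\int\|\xi\|^2d\Lambda(\xi)<\infty,\qquad C_4=\int\|\xi\|^4d\Lambda(\xi)<\infty,\qquad C_8=\int\|\xi\|^8d\Lambda(\xi)<\infty .$$ Then, for all $\alpha\in\mathbb{R}$, $$\mathrm{MMD}_k(\mathcal L(X),\mathcal L(\varphi_\alpha(Y)))\le K_1\sigma^2,\qquad K_1=\frac{\sqrt{4\alpha^2CC_2+C_4}}{\sqrt2},$$ and furthermore, for $\alpha=\tfrac12$, $$\mathrm{MMD}_k(\mathcal L(X),\mathcal L(\varphi_{1/2}(Y)))\le K_2\sigma^4,\qquad K_2=\frac{\sqrt{C^2C_4+C_8}}{4\sqrt2}.$$ -/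

import Mathlib

open MeasureTheory ProbabilityTheory
open scoped Gradient ContDiff RealInnerProductSpace

/-- The maximum mean discrepancy of two laws with respect to a reproducing kernel Hilbert space `H`
of real functions: the supremum of `E[f(Z₁)] - E[f(Z₂)]` over the unit ball of `H`, taken in the
extended reals. -/
noncomputable def MMD {E : Type*} [MeasurableSpace E] (H : Type*) [NormedAddCommGroup H]
    [InnerProductSpace ℝ H] [RKHS ℝ H E ℝ] (μ ν : Measure E) : EReal :=
  ⨆ f : {f : H // ‖f‖ ≤ 1}, (((∫ x, f.1 x ∂μ) - ∫ x, f.1 x ∂ν : ℝ) : EReal)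

/-- `p` is a density, with respect to the Lebesgue measure, of the random vector `Z`. -/
structure HasDensity {Ω : Type*} [MeasurableSpace Ω] {d : ℕ} (Z : Ω → EuclideanSpace ℝ (Fin d))
    (p : EuclideanSpace ℝ (Fin d) → ℝ) (P : Measure Ω) : Prop where
  measurable : Measurable p
  nonneg : ∀ x, 0 ≤ p x
  hasLaw : HasLaw Z (volume.withDensity fun x => ENNReal.ofReal (p x)) P

/-- `G` is the weak (distributional) gradient of `p`: both are locally integrable and
`∫ p ∇φ = - ∫ φ G` for every smooth compactly supported test function `φ`. -/
structure HasWeakGradient {d : ℕ} (p : EuclideanSpace ℝ (Fin d) → ℝ)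
    (G : EuclideanSpace ℝ (Fin d) → EuclideanSpace ℝ (Fin d)) : Prop where
  locallyIntegrable : LocallyIntegrable p volume
  locallyIntegrable_grad : LocallyIntegrable G volume
  integral_eq : ∀ φ : EuclideanSpace ℝ (Fin d) → ℝ, ContDiff ℝ ∞ φ → HasCompactSupport φ →
    ∫ x, p x • ∇ φ x = -∫ x, φ x • G x

/-- The score `∇ log p = ∇p / p` of a density `p` with (weak) gradient `G`. The value on the set
`{p = 0}`, which is null for the law of density `p`, is irrelevant (it is `0` here). -/
noncomputable def score {d : ℕ} (p : EuclideanSpace ℝ (Fin d) → ℝ)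
    (G : EuclideanSpace ℝ (Fin d) → EuclideanSpace ℝ (Fin d))
    (x : EuclideanSpace ℝ (Fin d)) : EuclideanSpace ℝ (Fin d) :=
  (p x)⁻¹ • G x

/-- The denoiser `φ_α(y) = y + α σ² ∇ log p_Y(y)`. -/
noncomputable def denoiser {d : ℕ} (pY : EuclideanSpace ℝ (Fin d) → ℝ) (σ α : ℝ)
    (y : EuclideanSpace ℝ (Fin d)) : EuclideanSpace ℝ (Fin d) :=
  y + (α * σ ^ 2) • ∇ (fun z => Real.log (pY z)) y

/-! By the reproducing property, the MMD is at most the norm of the difference of the mean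
embeddings, and Fubini turns the square of that norm into `∫ |φ_X - φ_Z|² dΛ`, with `φ` the
characteristic functions and `Z` the denoised variable (`norm_integral_kerFun_sub_sq`). A pointwise
bound on `φ_X - φ_Z` therefore suffices.

Put `t = σ²‖ξ‖²/2` and let `s = ∇ log p_Y`. Independence gives `φ_Y = exp(-t) φ_X`, which is within
`t` of `φ_X`. Moving `Y` by `ασ² s(Y)` changes the characteristic function by at most `|α|σ²‖ξ‖
E‖s(Y)‖`. This gives order `σ²`. For `α = 1/2`, expand the displacement to second order. Integration
by parts (`integral_cexp_mul_inner_gradient_log`) evaluates the linear term as exactly `t φ_Y`, so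
the main error becomes `1 - (1 + t) exp(-t) = O(t²)`, and the remainder is of order `σ⁴ E‖s(Y)‖²`.

Both cases need `E‖s(Y)‖² ≤ C`: the score of `Y` is a posterior average of the score of `X`, so
Jensen applies. For a weak gradient `G` this requires `G = p · score` almost everywhere, hence `G =
0` a.e. on `{p = 0}` (`HasWeakGradient.ae_eq_zero_of_eq_zero`). Indeed a nonnegative function can
only increase away from its zeros, so there its derivative is nonnegative in every direction and in
the opposite one. -/

/-! ### The feature map of a translation-invariant kernel -/

theorem norm_kerFun_one_sub_sq {E H : Type*} [AddCommGroup E] [NormedAddCommGroup H]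
    [InnerProductSpace ℝ H] [CompleteSpace H] [RKHS ℝ H E ℝ] {ψ : E → ℝ} (hψ : ∀ x y, RKHS.kernel H x y 1 = ψ (x - y))
    (x y : E) : ‖RKHS.kerFun H x 1 - RKHS.kerFun H y 1‖ ^ 2
      = ψ 0 - ψ (y - x) - ψ (x - y) + ψ 0 := by
  rw [← real_inner_self_eq_norm_sq, inner_sub_left, inner_sub_right, inner_sub_right]
  simp only [RKHS.kerFun_inner, RKHS.kerFun_apply, hψ, sub_self]
  simp
  ring

theorem continuous_kerFun_one {E H : Type*} [AddCommGroup E] [TopologicalSpace E]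
    [IsTopologicalAddGroup E] [NormedAddCommGroup H] [InnerProductSpace ℝ H] [CompleteSpace H]
    [RKHS ℝ H E ℝ] {ψ : E → ℝ} (hψ : ∀ x y, RKHS.kernel H x y 1 = ψ (x - y))
    (hψc : Continuous ψ) : Continuous fun x : E => RKHS.kerFun H x 1 := by
  rw [continuous_iff_continuousAt]
  intro x
  rw [ContinuousAt, tendsto_iff_norm_sub_tendsto_zero]
  have h : Filter.Tendsto (fun y => √(ψ 0 - ψ (x - y) - ψ (y - x) + ψ 0)) (nhds x) (nhds 0) := by
    have hc : Continuous fun y => √(ψ 0 - ψ (x - y) - ψ (y - x) + ψ 0) := by fun_prop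
    simpa using hc.tendsto x
  refine h.congr fun y => ?_
  rw [← norm_kerFun_one_sub_sq hψ, Real.sqrt_sq (norm_nonneg _)]

/-- Continuity on a second countable space gives strong measurability without separability of `H`,
and the feature map has constant norm `√(ψ 0)`. Hence mean embeddings exist as Bochner integrals. -/
theorem integrable_kerFun_one {E H : Type*} [NormedAddCommGroup E] [SecondCountableTopology E]
    [MeasurableSpace E] [BorelSpace E] [NormedAddCommGroup H] [InnerProductSpace ℝ H]
    [CompleteSpace H] [RKHS ℝ H E ℝ] {ψ : E → ℝ} (hψ : ∀ x y, RKHS.kernel H x y 1 = ψ (x - y))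
    (hψc : Continuous ψ) (μ : Measure E) [IsFiniteMeasure μ] :
    Integrable (fun x : E => RKHS.kerFun H x 1) μ := by
  refine Integrable.of_bound (C := √(ψ 0))
    (continuous_kerFun_one hψ hψc).aestronglyMeasurable (.of_forall fun x => ?_)
  rw [← Real.sqrt_sq (norm_nonneg _), ← real_inner_self_eq_norm_sq, RKHS.kerFun_inner,
    RKHS.kerFun_apply, hψ]
  simp

theorem integral_eq_inner_integral_kerFun {E H : Type*} [NormedAddCommGroup E]
    [SecondCountableTopology E] [MeasurableSpace E] [BorelSpace E] [NormedAddCommGroup H]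
    [InnerProductSpace ℝ H] [CompleteSpace H] [RKHS ℝ H E ℝ] {ψ : E → ℝ}
    (hψ : ∀ x y, RKHS.kernel H x y 1 = ψ (x - y)) (hψc : Continuous ψ)
    (μ : Measure E) [IsFiniteMeasure μ] (f : H) :
    ∫ x, f x ∂μ = ⟪f, ∫ x, RKHS.kerFun H x 1 ∂μ⟫ := by
  rw [← integral_inner (integrable_kerFun_one hψ hψc μ)]
  simp

/-! ### Mean embeddings and characteristic functions -/

section MeanEmbedding

variable {E : Type*} [NormedAddCommGroup E] [InnerProductSpace ℝ E] [MeasurableSpace E]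
  [BorelSpace E]

theorem continuous_of_eq_integral_cexp {ψ : E → ℝ} {Λ : Measure E} [IsFiniteMeasure Λ]
    (hΛ : ∀ x, (ψ x : ℂ) = ∫ ξ, Complex.exp (-(Complex.I * (⟪ξ, x⟫ : ℝ))) ∂Λ) :
    Continuous ψ := by
  have h : Continuous fun x => ∫ ξ, Complex.exp (-(Complex.I * (⟪ξ, x⟫ : ℝ))) ∂Λ := by
    refine continuous_of_dominated (bound := fun _ => 1) (fun x => ?_) (fun x => ?_)
      (integrable_const _) ?_
    · exact (by fun_prop : Continuous _).aestronglyMeasurable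
    · exact .of_forall fun ξ => by simp [Complex.norm_exp]
    · exact .of_forall fun ξ => by fun_prop
  have h' : ψ = fun x => (∫ ξ, Complex.exp (-(Complex.I * (⟪ξ, x⟫ : ℝ))) ∂Λ).re := by
    ext x; rw [← hΛ, Complex.ofReal_re]
  rw [h']
  exact Complex.continuous_re.comp h

variable [SecondCountableTopology E]

/-- Fubini: the character at `x - y` factors, and its `y` part integrates to `charFun μ`. -/
theorem integral_translate_eq_integral_charFun {ψ : E → ℝ} {Λ : Measure E} [IsFiniteMeasure Λ]
    (hΛ : ∀ x, (ψ x : ℂ) = ∫ ξ, Complex.exp (-(Complex.I * (⟪ξ, x⟫ : ℝ))) ∂Λ)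
    (μ : Measure E) [IsFiniteMeasure μ] (x : E) :
    ((∫ y, ψ (x - y) ∂μ : ℝ) : ℂ)
      = ∫ ξ, Complex.exp (-(Complex.I * (⟪ξ, x⟫ : ℝ))) * charFun μ ξ ∂Λ := by
  rw [← integral_complex_ofReal]
  simp_rw [hΛ]
  rw [integral_integral_swap]
  · refine integral_congr_ae (.of_forall fun ξ => ?_)
    simp only [charFun_apply]
    rw [← integral_const_mul]
    refine integral_congr_ae (.of_forall fun y => ?_)
    simp only
    rw [← Complex.exp_add, inner_sub_right, real_inner_comm ξ y]
    congr 1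
    push_cast
    ring
  · refine Integrable.of_bound (C := 1) ?_ (.of_forall fun z => ?_)
    · exact (by unfold Function.uncurry; fun_prop : Continuous _).aestronglyMeasurable
    · simp [Complex.norm_exp, Function.uncurry]

theorem integral_integral_cexp_mul {Λ : Measure E} [IsFiniteMeasure Λ]
    (μ : Measure E) [IsFiniteMeasure μ] {D : E → ℂ} (hD : Continuous D) {B : ℝ}
    (hB : ∀ ξ, ‖D ξ‖ ≤ B) :
    ∫ x, ∫ ξ, Complex.exp (-(Complex.I * (⟪ξ, x⟫ : ℝ))) * D ξ ∂Λ ∂μ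
      = ∫ ξ, (starRingEnd ℂ) (charFun μ ξ) * D ξ ∂Λ := by
  rw [integral_integral_swap]
  · refine integral_congr_ae (.of_forall fun ξ => ?_)
    simp only
    rw [integral_mul_const, ← charFun_neg, charFun_apply]
    congr 2
    ext x
    rw [inner_neg_right, real_inner_comm]
    congr 1
    push_cast
    ring
  · refine Integrable.of_bound (C := B) ?_ (.of_forall fun z => ?_)
    · exact (by unfold Function.uncurry; fun_prop : Continuous _).aestronglyMeasurable
    · simpa [Complex.norm_exp, Function.uncurry] using hB z.2

variable {H : Type*} [NormedAddCommGroup H] [InnerProductSpace ℝ H] [CompleteSpace H]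
  [RKHS ℝ H E ℝ]

/-- The difference `m` of the embeddings satisfies `‖m‖² = ∫ m dμ - ∫ m dν`, while `m` as a function
is the Fourier integral of `D` against `Λ`. A second use of Fubini produces `conj D * D`. -/
theorem norm_integral_kerFun_sub_sq {ψ : E → ℝ}
    (hψ : ∀ x y, RKHS.kernel H x y 1 = ψ (x - y)) {Λ : Measure E} [IsFiniteMeasure Λ]
    (hΛ : ∀ x, (ψ x : ℂ) = ∫ ξ, Complex.exp (-(Complex.I * (⟪ξ, x⟫ : ℝ))) ∂Λ)
    (μ ν : Measure E) [IsProbabilityMeasure μ] [IsProbabilityMeasure ν] :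
    ‖∫ x, RKHS.kerFun H x 1 ∂μ - ∫ x, RKHS.kerFun H x 1 ∂ν‖ ^ 2
      = ∫ ξ, ‖charFun μ ξ - charFun ν ξ‖ ^ 2 ∂Λ := by
  have hψc := continuous_of_eq_integral_cexp hΛ
  set m := ∫ x, RKHS.kerFun H x 1 ∂μ - ∫ x, RKHS.kerFun H x 1 ∂ν with hm
  set D : E → ℂ := fun ξ => charFun μ ξ - charFun ν ξ with hD
  have hDc : Continuous D := by fun_prop
  have hDb : ∀ ξ, ‖D ξ‖ ≤ 2 := fun ξ => by
    refine (norm_sub_le _ _).trans ?_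
    linarith [norm_charFun_le_one (μ := μ) ξ, norm_charFun_le_one (μ := ν) ξ]
  have hintexp : ∀ (x : E) (ρ : Measure E) [IsProbabilityMeasure ρ],
      Integrable (fun ξ => Complex.exp (-(Complex.I * (⟪ξ, x⟫ : ℝ))) * charFun ρ ξ) Λ :=
    fun x ρ _ => by
      refine Integrable.of_bound (C := 1)
        (by fun_prop : Continuous _).aestronglyMeasurable (.of_forall fun ξ => ?_)
      simpa [Complex.norm_exp] using norm_charFun_le_one (μ := ρ) ξ
  have happ : ∀ (x : E) (ρ : Measure E) [IsProbabilityMeasure ρ],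
      (∫ y, RKHS.kerFun H y 1 ∂ρ) x = ∫ y, ψ (x - y) ∂ρ := fun x ρ _ => by
    have := RKHS.kerFun_inner (H := H) x (1 : ℝ) (∫ y, RKHS.kerFun H y 1 ∂ρ)
    rw [← integral_inner (integrable_kerFun_one hψ hψc ρ)] at this
    simp only [RKHS.kerFun_inner, RKHS.kerFun_apply, hψ] at this
    simpa using this.symm
  have hmx : ∀ x : E, ((m x : ℝ) : ℂ)
      = ∫ ξ, Complex.exp (-(Complex.I * (⟪ξ, x⟫ : ℝ))) * D ξ ∂Λ := fun x => by
    rw [hm, RKHS.coe_sub, Pi.sub_apply, happ, happ, Complex.ofReal_sub,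
      integral_translate_eq_integral_charFun hΛ, integral_translate_eq_integral_charFun hΛ,
      ← integral_sub (hintexp x μ) (hintexp x ν)]
    simp only [hD, mul_sub]
  have hsq : ‖m‖ ^ 2 = ∫ x, m x ∂μ - ∫ x, m x ∂ν := by
    rw [integral_eq_inner_integral_kerFun hψ hψc, integral_eq_inner_integral_kerFun hψ hψc,
      ← inner_sub_right, real_inner_self_eq_norm_sq]
  have hintD : ∀ (ρ : Measure E) [IsProbabilityMeasure ρ],
      Integrable (fun ξ => (starRingEnd ℂ) (charFun ρ ξ) * D ξ) Λ := fun ρ _ => by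
    refine Integrable.of_bound (C := 1 * 2) ?_ (.of_forall fun ξ => ?_)
    · exact (Continuous.mul (Complex.continuous_conj.comp (by fun_prop)) hDc).aestronglyMeasurable
    · rw [norm_mul, RCLike.norm_conj]
      exact mul_le_mul (norm_charFun_le_one ξ) (hDb ξ) (norm_nonneg _) zero_le_one
  have hc : ((‖m‖ ^ 2 : ℝ) : ℂ) = ((∫ ξ, ‖D ξ‖ ^ 2 ∂Λ : ℝ) : ℂ) := by
    rw [hsq, Complex.ofReal_sub, ← integral_complex_ofReal, ← integral_complex_ofReal,
      ← integral_complex_ofReal]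
    simp_rw [hmx]
    rw [integral_integral_cexp_mul μ hDc hDb, integral_integral_cexp_mul ν hDc hDb,
      ← integral_sub (hintD μ) (hintD ν)]
    refine integral_congr_ae (.of_forall fun ξ => ?_)
    simp only
    rw [← sub_mul, ← map_sub, Complex.conj_mul']
    push_cast
    rfl
  exact_mod_cast hc

/-- The maximum mean discrepancy of a translation-invariant kernel is bounded by the `L²` distance
of the characteristic functions with respect to the spectral measure. -/
theorem MMD_le_of_integral_charFun_le {ψ : E → ℝ}
    (hψ : ∀ x y, RKHS.kernel H x y 1 = ψ (x - y)) {Λ : Measure E} [IsFiniteMeasure Λ]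
    (hΛ : ∀ x, (ψ x : ℂ) = ∫ ξ, Complex.exp (-(Complex.I * (⟪ξ, x⟫ : ℝ))) ∂Λ)
    (μ ν : Measure E) [IsProbabilityMeasure μ] [IsProbabilityMeasure ν] {B : ℝ} (hB0 : 0 ≤ B)
    (hB : ∫ ξ, ‖charFun μ ξ - charFun ν ξ‖ ^ 2 ∂Λ ≤ B ^ 2) :
    MMD H μ ν ≤ (B : EReal) := by
  have hψc := continuous_of_eq_integral_cexp hΛ
  refine iSup_le fun f => EReal.coe_le_coe_iff.2 ?_
  rw [integral_eq_inner_integral_kerFun hψ hψc, integral_eq_inner_integral_kerFun hψ hψc,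
    ← inner_sub_right]
  rw [← norm_integral_kerFun_sub_sq hψ hΛ, sq_le_sq₀ (norm_nonneg _) hB0] at hB
  calc _ ≤ ‖f.1‖ * _ := real_inner_le_norm _ _
    _ ≤ 1 * B := mul_le_mul f.2 hB (norm_nonneg _) zero_le_one
    _ = B := one_mul B

end MeanEmbedding

/-! ### Translations along a segment -/

section Translation

variable {E : Type*} [NormedAddCommGroup E] [NormedSpace ℝ E] [FiniteDimensional ℝ E]
  [MeasurableSpace E] [BorelSpace E] (μ : Measure E) [μ.IsAddHaarMeasure]

/-- Translation is continuous in `L¹`, and integration over `s` is continuous on `L¹`. -/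
theorem continuous_setIntegral_add_smul {f : E → ℝ} (hf : Integrable f μ) (s : Set E) (z : E) :
    Continuous fun t : ℝ => ∫ x in s, f (x + t • z) ∂μ := by
  have : Fact ((1 : ENNReal) ≤ 1) := ⟨le_rfl⟩
  let g : C(ℝ, C(E, E)) :=
    ContinuousMap.curry ⟨fun q : ℝ × E => q.2 + q.1 • z, by fun_prop⟩
  have hg : ∀ t : ℝ, MeasurePreserving (g t) μ μ := fun t =>
    measurePreserving_add_right μ (t • z)
  have hc := Continuous.compMeasurePreservingLp (p := 1) (f := fun _ : ℝ => hf.toL1 f)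
    continuous_const g.continuous hg ENNReal.one_ne_top
  have hi := (continuous_setIntegral s).comp hc
  refine hi.congr fun t => ?_
  refine integral_congr_ae (ae_restrict_of_ae ?_)
  refine (Lp.coeFn_compMeasurePreserving (hf.toL1 f) (hg t)).trans ?_
  exact (hg t).quasiMeasurePreserving.ae_eq_comp hf.coeFn_toL1

theorem integrable_add_smul_prod {f : E → ℝ} (hf : Integrable f μ) (z : E) :
    Integrable (fun q : ℝ × E => f (q.2 + q.1 • z))
      ((volume.restrict (Set.Ioc (0 : ℝ) 1)).prod μ) := by
  -- The shear `(t, x) ↦ (t, x + t z)` preserves the product measure.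
  have hmp : MeasurePreserving (fun q : ℝ × E => (q.1, q.2 + q.1 • z))
      ((volume.restrict (Set.Ioc (0 : ℝ) 1)).prod μ)
      ((volume.restrict (Set.Ioc (0 : ℝ) 1)).prod μ) :=
    (MeasurePreserving.id _).skew_product (g := fun t x => x + t • z)
      (by unfold Function.uncurry; fun_prop)
      (.of_forall fun t => (measurePreserving_add_right μ (t • z)).map_eq)
  exact hmp.integrable_comp_of_integrable (hf.comp_snd _)

theorem integral_mul_intervalIntegral_add_smul {f u : E → ℝ} (hf : Integrable f μ)
    (hu : Measurable u) {B : ℝ} (hB : ∀ x, |u x| ≤ B) (z : E) :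
    ∫ x, (u x * ∫ t in (0 : ℝ)..1, f (x + t • z)) ∂μ
      = ∫ t in (0 : ℝ)..1, ∫ x, u x * f (x + t • z) ∂μ := by
  simp_rw [intervalIntegral.integral_of_le zero_le_one, ← integral_const_mul]
  refine (integral_integral_swap ?_).symm
  refine (integrable_add_smul_prod μ hf z).bdd_mul (c := B) ?_ (.of_forall fun q => ?_)
  · exact (hu.comp measurable_snd).aestronglyMeasurable
  · exact hB q.2

theorem integrable_intervalIntegral_add_smul {f : E → ℝ} (hf : Integrable f μ) (z : E) :
    Integrable (fun x => ∫ t in (0 : ℝ)..1, f (x + t • z)) μ := by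
  simp_rw [intervalIntegral.integral_of_le zero_le_one]
  exact (integrable_add_smul_prod μ hf z).integral_prod_right

end Translation

/-! ### Weak gradients, and their vanishing on the zero set -/

section WeakGradient

variable {d : ℕ} {p : EuclideanSpace ℝ (Fin d) → ℝ}
  {G : EuclideanSpace ℝ (Fin d) → EuclideanSpace ℝ (Fin d)}

theorem HasWeakGradient.integral_fderiv_mul (h : HasWeakGradient p G)
    {φ : EuclideanSpace ℝ (Fin d) → ℝ} (hφ : ContDiff ℝ ∞ φ) (hφc : HasCompactSupport φ)
    (z : EuclideanSpace ℝ (Fin d)) :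
    ∫ x, fderiv ℝ φ x z * p x = -∫ x, φ x * ⟪G x, z⟫ := by
  have hgrad : Continuous (∇ φ) :=
    (InnerProductSpace.toDual ℝ _).symm.continuous.comp (hφ.continuous_fderiv (by simp))
  have hgradc : HasCompactSupport (∇ φ) :=
    (hφc.fderiv ℝ).comp_left (map_zero (InnerProductSpace.toDual ℝ _).symm)
  have h1 : Integrable (fun x => p x • ∇ φ x) :=
    h.locallyIntegrable.integrable_smul_right_of_hasCompactSupport hgrad hgradc
  have h2 : Integrable (fun x => φ x • G x) :=
    h.locallyIntegrable_grad.integrable_smul_left_of_hasCompactSupport hφ.continuous hφc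
  have := congrArg (fun v => ⟪z, v⟫) (h.integral_eq φ hφ hφc)
  simp only [inner_neg_right] at this
  rw [← integral_inner h1, ← integral_inner h2] at this
  calc _ = ∫ x, ⟪z, p x • ∇ φ x⟫ := integral_congr_ae (.of_forall fun x => by
        simp only
        rw [inner_smul_right, real_inner_comm, gradient, InnerProductSpace.toDual_symm_apply,
          mul_comm])
    _ = -∫ x, ⟪z, φ x • G x⟫ := this
    _ = _ := congrArg _ (integral_congr_ae (.of_forall fun x => by
        simp only
        rw [inner_smul_right, real_inner_comm]))

/-- Translating the test function instead of `p` makes `t ↦ ∫ φ(x - t z) p(x) dx` differentiable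
with no regularity of `p`; this is then the fundamental theorem of calculus on `[0, 1]`. -/
theorem HasWeakGradient.integral_mul_translate_sub (h : HasWeakGradient p G) (hp : Integrable p)
    {φ : EuclideanSpace ℝ (Fin d) → ℝ} (hφ : ContDiff ℝ ∞ φ) (hφc : HasCompactSupport φ)
    (z : EuclideanSpace ℝ (Fin d)) :
    (∫ x, φ x * p (x + z)) - ∫ x, φ x * p x
      = ∫ t in (0 : ℝ)..1, ∫ x, φ x * ⟪G (x + t • z), z⟫ := by
  have hdc : Continuous (fderiv ℝ φ) := hφ.continuous_fderiv (by simp)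
  obtain ⟨M, hM⟩ := hdc.bounded_above_of_compact_support (hφc.fderiv ℝ)
  obtain ⟨M₀, hM₀⟩ := hφ.continuous.bounded_above_of_compact_support hφc
  have hbound : ∀ (t : ℝ) x, ‖-(fderiv ℝ φ (x - t • z) z) * p x‖ ≤ M * ‖z‖ * ‖p x‖ := fun t x => by
    rw [norm_mul, norm_neg]
    gcongr
    exact (ContinuousLinearMap.le_opNorm _ _).trans (by gcongr; exact hM _)
  have hmeas : ∀ t : ℝ,
      AEStronglyMeasurable (fun x => -(fderiv ℝ φ (x - t • z) z) * p x) volume := fun t =>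
    (by fun_prop : Continuous fun x => -(fderiv ℝ φ (x - t • z) z)).aestronglyMeasurable.mul
      hp.aestronglyMeasurable
  have hint : Integrable fun x => M * ‖z‖ * ‖p x‖ := hp.norm.const_mul _
  have hderiv : ∀ t : ℝ, HasDerivAt (fun t : ℝ => ∫ x, φ (x - t • z) * p x)
      (∫ x, -(fderiv ℝ φ (x - t • z) z) * p x) t := fun t => by
    refine (hasDerivAt_integral_of_dominated_loc_of_deriv_le Filter.univ_mem
      (.of_forall fun t => ?_) ?_ (hmeas t) (.of_forall fun x t _ => hbound t x) hint
      (.of_forall fun x t _ => ?_)).2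
    · exact (by fun_prop : Continuous fun x => φ (x - t • z)).aestronglyMeasurable.mul
        hp.aestronglyMeasurable
    · exact hp.bdd_mul (c := M₀)
        (by fun_prop : Continuous fun x => φ (x - t • z)).aestronglyMeasurable
        (.of_forall fun x => hM₀ _)
    · have hl : HasDerivAt (fun t : ℝ => x - t • z) (-z) t := by
        simpa using ((hasDerivAt_id t).smul_const z).const_sub x
      have := ((hφ.differentiable (by simp)) (x - t • z)).hasFDerivAt.comp_hasDerivAt t hl
      simpa using this.mul_const (p x)
  have hcont : Continuous fun t : ℝ => ∫ x, -(fderiv ℝ φ (x - t • z) z) * p x :=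
    continuous_of_dominated hmeas (fun t => .of_forall (hbound t)) hint
      (.of_forall fun x => by fun_prop)
  have hftc := intervalIntegral.integral_eq_sub_of_hasDerivAt (a := 0) (b := 1)
    (fun t _ => hderiv t) (hcont.intervalIntegrable _ _)
  -- The weak gradient identity takes the derivative off `φ`, and the change of variables `x ↦ x + t
  -- z` undoes the translation.
  have heq : ∀ t : ℝ, ∫ x, -(fderiv ℝ φ (x - t • z) z) * p x
      = ∫ x, φ x * ⟪G (x + t • z), z⟫ := fun t => by
    have hφt : ContDiff ℝ ∞ fun x => φ (x - t • z) := hφ.comp (contDiff_id.sub contDiff_const)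
    have hφtc : HasCompactSupport fun x => φ (x - t • z) :=
      hφc.comp_homeomorph (Homeomorph.subRight (t • z))
    have := h.integral_fderiv_mul hφt hφtc z
    simp only [fderiv_comp_sub] at this
    simp only [neg_mul, integral_neg, this, neg_neg]
    rw [← integral_add_right_eq_self _ (t • z)]
    simp
  simp_rw [heq] at hftc
  rw [hftc]
  congr 1
  · rw [← integral_add_right_eq_self (fun x => φ (x - (1 : ℝ) • z) * p x) z]
    simp
  · simp

/-- A Sobolev function is a.e. the integral of its weak gradient along segments. -/
theorem HasWeakGradient.ae_translate_sub_eq (h : HasWeakGradient p G) (hp : Integrable p)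
    (R : ℝ) {z : EuclideanSpace ℝ (Fin d)} (hz : ‖z‖ ≤ 1) :
    ∀ᵐ x, x ∈ Metric.ball (0 : EuclideanSpace ℝ (Fin d)) R → p (x + z) - p x
      = ∫ t in (0 : ℝ)..1, ⟪(Metric.closedBall 0 (R + 1)).indicator G (x + t • z), z⟫ := by
  -- Truncation makes `G` integrable. The radius `R + 1` keeps `x + t z` inside for `‖x‖ < R`, `t ∈
  -- [0, 1]` and `‖z‖ ≤ 1`.
  set G' := (Metric.closedBall (0 : EuclideanSpace ℝ (Fin d)) (R + 1)).indicator G with hG'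
  have hG'i : Integrable fun x => ⟪G' x, z⟫ := by
    refine Integrable.inner_const ?_ z
    rw [hG', integrable_indicator_iff measurableSet_closedBall]
    exact h.locallyIntegrable_grad.integrableOn_isCompact (isCompact_closedBall _ _)
  have hpz : Integrable fun x => p (x + z) := hp.comp_add_right z
  have hli := (hpz.sub hp).sub (integrable_intervalIntegral_add_smul volume hG'i z)
  suffices h0 : ∀ φ : EuclideanSpace ℝ (Fin d) → ℝ, ContDiff ℝ ∞ φ → HasCompactSupport φ →
      tsupport φ ⊆ Metric.ball 0 R → ∫ x, φ x • (p (x + z) - p x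
        - ∫ t in (0 : ℝ)..1, ⟪G' (x + t • z), z⟫) = 0 by
    filter_upwards [Metric.isOpen_ball.ae_eq_zero_of_integral_contDiff_smul_eq_zero
      (hli.locallyIntegrable.locallyIntegrableOn _) h0] with x hx hxR
    exact sub_eq_zero.1 (hx hxR)
  intro φ hφ hφc hφs
  obtain ⟨M, hM⟩ := hφ.continuous.bounded_above_of_compact_support hφc
  have hmul : ∀ {f : EuclideanSpace ℝ (Fin d) → ℝ}, Integrable f →
      Integrable fun x => φ x * f x := fun hf =>
    hf.bdd_mul hφ.continuous.aestronglyMeasurable (.of_forall hM)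
  simp only [smul_eq_mul, mul_sub]
  rw [integral_sub (f := fun x => φ x * p (x + z) - φ x * p x) ((hmul hpz).sub (hmul hp))
      (hmul (integrable_intervalIntegral_add_smul volume hG'i z)),
    integral_sub (hmul hpz) (hmul hp),
    integral_mul_intervalIntegral_add_smul volume hG'i hφ.continuous.measurable hM z,
    h.integral_mul_translate_sub hp hφ hφc, sub_eq_zero]
  refine intervalIntegral.integral_congr fun t ht => integral_congr_ae (.of_forall fun x => ?_)
  simp only
  by_cases hx : x ∈ tsupport φ
  · rw [hG', Set.indicator_of_mem]
    rw [Set.uIcc_of_le zero_le_one] at ht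
    rw [mem_closedBall_zero_iff]
    refine (norm_add_le _ _).trans (add_le_add (mem_ball_zero_iff.1 (hφs hx)).le ?_)
    rw [norm_smul, Real.norm_of_nonneg ht.1]
    exact mul_le_one₀ ht.2 (norm_nonneg _) hz
  · rw [image_eq_zero_of_notMem_tsupport hx, zero_mul, zero_mul]

/-- On `s` one has `p (x + r z) - p x = p (x + r z) ≥ 0`. Writing this as an integral along the
segment, dividing by `r` and letting `r → 0⁺` gives the sign of the directional derivative, averaged
over `s`. -/
theorem HasWeakGradient.setIntegral_inner_nonneg (h : HasWeakGradient p G) (hp : Integrable p)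
    (hp0 : ∀ x, 0 ≤ p x) {R : ℝ} {s : Set (EuclideanSpace ℝ (Fin d))} (hs : MeasurableSet s)
    (hsR : s ⊆ Metric.ball 0 R) (hsp : ∀ x ∈ s, p x = 0) (z : EuclideanSpace ℝ (Fin d))
    (hz : ‖z‖ ≤ 1) : 0 ≤ ∫ x in s, ⟪G x, z⟫ := by
  set G' := (Metric.closedBall (0 : EuclideanSpace ℝ (Fin d)) (R + 1)).indicator G with hG'
  have hG'i : Integrable fun x => ⟪G' x, z⟫ := by
    refine Integrable.inner_const ?_ z
    rw [hG', integrable_indicator_iff measurableSet_closedBall]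
    exact h.locallyIntegrable_grad.integrableOn_isCompact (isCompact_closedBall _ _)
  set N : ℝ → ℝ := fun t => ∫ x in s, ⟪G' (x + t • z), z⟫ with hN
  have hNc : Continuous N := continuous_setIntegral_add_smul volume hG'i s z
  have hind : ∀ f : EuclideanSpace ℝ (Fin d) → ℝ,
      ∫ x, s.indicator 1 x * f x = ∫ x in s, f x := fun f => by
    rw [← integral_indicator hs]
    refine integral_congr_ae (.of_forall fun x => ?_)
    by_cases hx : x ∈ s <;> simp [hx]
  have hpos : ∀ r ∈ Set.Ioc (0 : ℝ) 1, 0 ≤ ∫ t in (0 : ℝ)..1, N (t * r) := fun r hr => by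
    have hrz : ‖r • z‖ ≤ 1 := by
      rw [norm_smul, Real.norm_of_nonneg hr.1.le]
      exact mul_le_one₀ hr.2 (norm_nonneg _) hz
    have hsw := integral_mul_intervalIntegral_add_smul volume hG'i
      (measurable_one.indicator hs :
        Measurable (s.indicator (1 : EuclideanSpace ℝ (Fin d) → ℝ))) (B := 1)
      (fun x => by by_cases hx : x ∈ s <;> simp [hx]) (r • z)
    simp_rw [hind, smul_smul] at hsw
    rw [hN, ← hsw]
    refine setIntegral_nonneg_of_ae_restrict ?_
    rw [Filter.EventuallyLE, ae_restrict_iff' hs]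
    filter_upwards [h.ae_translate_sub_eq hp R hrz] with x hx hxs
    have := hx (hsR hxs)
    rw [hsp x hxs, sub_zero] at this
    simp only [inner_smul_right, intervalIntegral.integral_const_mul, smul_smul] at this
    have h0 := this ▸ hp0 (x + r • z)
    exact nonneg_of_mul_nonneg_right h0 hr.1
  -- Since `N` is continuous, its average over the shrinking segment tends to `N 0`.
  have hlim : Filter.Tendsto (fun r : ℝ => ∫ t in (0 : ℝ)..1, N (t * r)) (nhdsWithin 0 (Set.Ioi 0))
      (nhds (N 0)) := by
    have hc : Continuous fun r : ℝ => ∫ t in (0 : ℝ)..1, N (t * r) :=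
      intervalIntegral.continuous_parametric_intervalIntegral_of_continuous'
        (f := fun r t => N (t * r)) (by unfold Function.uncurry; fun_prop) 0 1
    have := hc.tendsto 0
    simp only [mul_zero, intervalIntegral.integral_const, sub_zero, one_smul] at this
    exact this.mono_left nhdsWithin_le_nhds
  have h0 : 0 ≤ N 0 := ge_of_tendsto hlim
    (Filter.eventually_of_mem (Ioc_mem_nhdsGT zero_lt_one) hpos)
  refine h0.trans_eq (setIntegral_congr_fun hs fun x hx => ?_)
  simp only [zero_smul, add_zero]
  rw [hG', Set.indicator_of_mem]
  exact Metric.ball_subset_closedBall (Metric.ball_subset_ball (by linarith) (hsR hx))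

/-- The weak gradient of a nonnegative function vanishes a.e. on its zero set. -/
theorem HasWeakGradient.ae_eq_zero_of_eq_zero (h : HasWeakGradient p G) (hp : Integrable p)
    (hpm : Measurable p) (hp0 : ∀ x, 0 ≤ p x) : ∀ᵐ x, p x = 0 → G x = 0 := by
  have hA : MeasurableSet {x | p x = 0} := hpm (measurableSet_singleton 0)
  have key : ∀ z : EuclideanSpace ℝ (Fin d), ‖z‖ ≤ 1 → ∀ R : ℕ,
      ∀ᵐ x, x ∈ {x | p x = 0} ∩ Metric.ball 0 (R : ℝ) → 0 ≤ ⟪G x, z⟫ := fun z hz R => by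
    have hAR : MeasurableSet ({x | p x = 0} ∩ Metric.ball 0 (R : ℝ)) := hA.inter measurableSet_ball
    rw [← ae_restrict_iff' hAR]
    refine ae_nonneg_of_forall_setIntegral_nonneg ?_ fun s hs _ => ?_
    · refine Integrable.inner_const ?_ z
      exact (h.locallyIntegrable_grad.integrableOn_isCompact
        (isCompact_closedBall 0 (R : ℝ))).mono_set
          (Set.inter_subset_right.trans Metric.ball_subset_closedBall)
    · rw [Measure.restrict_restrict hs]
      exact h.setIntegral_inner_nonneg hp hp0 (hs.inter hAR) (R := R)
        (Set.inter_subset_right.trans Set.inter_subset_right) (fun x hx => hx.2.1) z hz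
  have hall : ∀ᵐ x, ∀ (i : Fin d) (R : ℕ), x ∈ {x | p x = 0} ∩ Metric.ball 0 (R : ℝ) →
      ⟪G x, EuclideanSpace.single i (1 : ℝ)⟫ = 0 := by
    rw [ae_all_iff]
    intro i
    rw [ae_all_iff]
    intro R
    -- Both signs of each basis vector are needed to turn nonnegativity into vanishing.
    filter_upwards [key (EuclideanSpace.single i 1) (by simp) R,
      key (-EuclideanSpace.single i 1) (by simp) R] with x h1 h2 hx
    have h2 := h2 hx
    rw [inner_neg_right] at h2
    exact le_antisymm (by linarith) (h1 hx)
  filter_upwards [hall] with x hx hpx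
  obtain ⟨R, hR⟩ := exists_nat_gt ‖x‖
  ext i
  have := hx i R ⟨hpx, by simpa using hR⟩
  rwa [EuclideanSpace.inner_single_right, one_mul] at this

end WeakGradient

/-! ### Integration by parts against bounded test functions -/

section IntegrationByParts

/-- Dilates `f (x / (n + 1))` of one bump function: the chain rule supplies the decay of the
derivative. -/
theorem exists_seq_smooth_cutoff (E : Type*) [NormedAddCommGroup E] [InnerProductSpace ℝ E]
    [FiniteDimensional ℝ E] :
    ∃ (χ : ℕ → E → ℝ) (K : ℝ), (∀ n, ContDiff ℝ ∞ (χ n)) ∧ (∀ n, HasCompactSupport (χ n)) ∧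
      (∀ n x, ‖χ n x‖ ≤ 1) ∧ (∀ n x, ‖fderiv ℝ (χ n) x‖ ≤ K * (1 / ((n : ℝ) + 1))) ∧
      ∀ x, Filter.Tendsto (fun n => χ n x) Filter.atTop (nhds 1) := by
  obtain ⟨f, hf⟩ : ∃ f : ContDiffBump (0 : E), f.rIn = 1 := ⟨⟨1, 2, one_pos, one_lt_two⟩, rfl⟩
  have hfs : ContDiff ℝ ∞ f := f.contDiff
  have hfd : Continuous (fderiv ℝ f) := hfs.continuous_fderiv (by simp)
  obtain ⟨K, hK⟩ := hfd.bounded_above_of_compact_support (f.hasCompactSupport.fderiv ℝ)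
  have hc0 : ∀ n : ℕ, (1 : ℝ) / ((n : ℝ) + 1) ≠ 0 := fun n => by positivity
  refine ⟨fun n x => f ((1 / ((n : ℝ) + 1)) • x), K, fun n => ?_, fun n => ?_, fun n x => ?_,
    fun n x => ?_, fun x => ?_⟩
  · exact hfs.comp (contDiff_const.smul contDiff_id)
  · exact f.hasCompactSupport.comp_homeomorph (Homeomorph.smulOfNeZero _ (hc0 n))
  · rw [Real.norm_of_nonneg f.nonneg]
    exact f.le_one
  · have := ((hfs.differentiable (by simp)) ((1 / ((n : ℝ) + 1)) • x)).hasFDerivAt.comp x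
      ((hasFDerivAt_id x).const_smul (1 / ((n : ℝ) + 1)))
    have h2 : HasFDerivAt (fun x => f ((1 / ((n : ℝ) + 1)) • x))
        ((1 / ((n : ℝ) + 1)) • fderiv ℝ f ((1 / ((n : ℝ) + 1)) • x)) x := by
      refine this.congr_fderiv ?_
      ext v
      simp
    rw [h2.fderiv, norm_smul, mul_comm K, Real.norm_of_nonneg (by positivity)]
    gcongr
    exact hK _
  · have hx : Filter.Tendsto (fun n : ℕ => (1 / ((n : ℝ) + 1)) • x) Filter.atTop (nhds 0) := by
      simpa using (tendsto_one_div_add_atTop_nhds_zero_nat (𝕜 := ℝ)).smul_const x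
    have := (hfs.continuous.tendsto 0).comp hx
    rwa [f.one_of_mem_closedBall (by simp [hf])] at this

/-- For an integrable function with integrable weak gradient, the test functions may be bounded
with bounded derivative instead of compactly supported. -/
theorem HasWeakGradient.integral_fderiv_mul_of_bounded {d : ℕ} {p : EuclideanSpace ℝ (Fin d) → ℝ}
    {G : EuclideanSpace ℝ (Fin d) → EuclideanSpace ℝ (Fin d)} (h : HasWeakGradient p G)
    (hp : Integrable p) (hG : Integrable G) {φ : EuclideanSpace ℝ (Fin d) → ℝ}
    (hφ : ContDiff ℝ ∞ φ) {M M' : ℝ} (hM : ∀ x, ‖φ x‖ ≤ M) (hM' : ∀ x, ‖fderiv ℝ φ x‖ ≤ M')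
    (z : EuclideanSpace ℝ (Fin d)) :
    ∫ x, fderiv ℝ φ x z * p x = -∫ x, φ x * ⟪G x, z⟫ := by
  obtain ⟨χ, K, hχ, hχc, hχ1, hχK, hχlim⟩ := exists_seq_smooth_cutoff (EuclideanSpace ℝ (Fin d))
  have hfd : ∀ n x, fderiv ℝ (fun x => χ n x * φ x) x z
      = χ n x * fderiv ℝ φ x z + fderiv ℝ (χ n) x z * φ x := fun n x => by
    have h2 : HasFDerivAt (fun x => χ n x * φ x) _ x :=
      ((hχ n).differentiable (by simp) x).hasFDerivAt.mul (hφ.differentiable (by simp) x).hasFDerivAt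
    rw [h2.fderiv]
    simp [mul_comm]
  have hus : ∀ n, ContDiff ℝ ∞ (fun x => χ n x * φ x) := fun n => (hχ n).mul hφ
  have hM0 : 0 ≤ M := (norm_nonneg _).trans (hM 0)
  have hM0' : 0 ≤ M' := (norm_nonneg _).trans (hM' 0)
  have hK0 : 0 ≤ K := by simpa using (norm_nonneg _).trans (hχK 0 0)
  have hχz : ∀ n x, ‖fderiv ℝ (χ n) x z‖ ≤ K * (1 / ((n : ℝ) + 1)) * ‖z‖ := fun n x =>
    (ContinuousLinearMap.le_opNorm _ _).trans (by gcongr; exact hχK n x)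
  -- In the product rule, the term with the derivative of the cutoff is `O(1 / (n + 1))`; dominated
  -- convergence handles both terms, with a multiple of `‖p‖` as bound.
  have hl : Filter.Tendsto (fun n => ∫ x, fderiv ℝ (fun x => χ n x * φ x) x z * p x) Filter.atTop
      (nhds (∫ x, fderiv ℝ φ x z * p x)) := by
    refine tendsto_integral_of_dominated_convergence
      (fun x => (1 * (M' * ‖z‖) + K * 1 * ‖z‖ * M) * ‖p x‖) (fun n => ?_)
      (hp.norm.const_mul _) (fun n => .of_forall fun x => ?_) (.of_forall fun x => ?_)
    · have := (hus n).continuous_fderiv (by simp)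
      exact (this.clm_apply continuous_const).aestronglyMeasurable.mul hp.aestronglyMeasurable
    · rw [norm_mul, hfd]
      gcongr
      refine (norm_add_le _ _).trans ?_
      rw [norm_mul, norm_mul]
      refine add_le_add (mul_le_mul (hχ1 n x) ?_ (norm_nonneg _) zero_le_one)
        (mul_le_mul ((hχz n x).trans ?_) (hM x) (norm_nonneg _) (by positivity))
      · exact (ContinuousLinearMap.le_opNorm _ _).trans (by gcongr; exact hM' _)
      · gcongr
        rw [div_le_one (by positivity)]
        linarith [n.cast_nonneg (α := ℝ)]
    · refine Filter.Tendsto.mul_const _ ?_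
      simp_rw [hfd]
      have h2 : Filter.Tendsto (fun n => fderiv ℝ (χ n) x z) Filter.atTop (nhds 0) := by
        refine squeeze_zero_norm (fun n => hχz n x) ?_
        simpa using ((tendsto_one_div_add_atTop_nhds_zero_nat (𝕜 := ℝ)).const_mul K).mul_const ‖z‖
      simpa using ((hχlim x).mul_const (fderiv ℝ φ x z)).add (h2.mul_const (φ x))
  have hr : Filter.Tendsto (fun n => -∫ x, χ n x * φ x * ⟪G x, z⟫) Filter.atTop
      (nhds (-∫ x, φ x * ⟪G x, z⟫)) := by
    refine Filter.Tendsto.neg ?_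
    have hGz : Integrable fun x => ⟪G x, z⟫ := hG.inner_const z
    refine tendsto_integral_of_dominated_convergence
      (fun x => 1 * M * ‖⟪G x, z⟫‖) (fun n => ?_)
      (hGz.norm.const_mul _) (fun n => .of_forall fun x => ?_) (.of_forall fun x => ?_)
    · exact (hus n).continuous.aestronglyMeasurable.mul hGz.aestronglyMeasurable
    · rw [norm_mul, norm_mul]
      exact mul_le_mul_of_nonneg_right
        (mul_le_mul (hχ1 n x) (hM x) (norm_nonneg _) zero_le_one) (norm_nonneg _)
    · simpa using ((hχlim x).mul_const (φ x)).mul_const ⟪G x, z⟫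
  exact tendsto_nhds_unique
    (hl.congr fun n => h.integral_fderiv_mul (hus n) (hχc n).mul_right z) hr

end IntegrationByParts

/-! ### The isotropic Gaussian density -/

section GaussianDensity

/-- The centred isotropic Gaussian density proportional to `exp (-b ‖x‖²)`. -/
noncomputable def isotropicGaussianPDF (d : ℕ) (b : ℝ) (x : EuclideanSpace ℝ (Fin d)) : ℝ :=
  ((Real.pi / b) ^ (d / 2 : ℝ))⁻¹ * Real.exp (-b * ‖x‖ ^ 2)

variable {d : ℕ} {b : ℝ}

theorem isotropicGaussianPDF_pos (hb : 0 < b) (x : EuclideanSpace ℝ (Fin d)) :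
    0 < isotropicGaussianPDF d b x := by
  unfold isotropicGaussianPDF
  positivity

theorem contDiff_isotropicGaussianPDF : ContDiff ℝ ∞ (isotropicGaussianPDF d b) :=
  contDiff_const.mul (contDiff_const.mul (contDiff_norm_sq ℝ)).exp

theorem isotropicGaussianPDF_le (hb : 0 < b) (x : EuclideanSpace ℝ (Fin d)) :
    ‖isotropicGaussianPDF d b x‖ ≤ ((Real.pi / b) ^ (d / 2 : ℝ))⁻¹ := by
  rw [Real.norm_of_nonneg (isotropicGaussianPDF_pos hb x).le, isotropicGaussianPDF]
  refine mul_le_of_le_one_right (by positivity) (Real.exp_le_one_iff.2 ?_)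
  nlinarith [sq_nonneg ‖x‖]

theorem fderiv_isotropicGaussianPDF (x : EuclideanSpace ℝ (Fin d)) :
    fderiv ℝ (isotropicGaussianPDF d b) x
      = (-2 * b * isotropicGaussianPDF d b x) • innerSL ℝ x := by
  have h := ((((hasStrictFDerivAt_norm_sq x).hasFDerivAt).const_mul (-b)).exp).const_mul
    ((Real.pi / b) ^ (d / 2 : ℝ))⁻¹
  refine (h.congr_fderiv ?_).fderiv
  ext v
  simp [isotropicGaussianPDF]
  ring

theorem exists_norm_fderiv_isotropicGaussianPDF_le (hb : 0 < b) :
    ∃ M, ∀ x : EuclideanSpace ℝ (Fin d), ‖fderiv ℝ (isotropicGaussianPDF d b) x‖ ≤ M := by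
  refine ⟨2 * b * (((Real.pi / b) ^ (d / 2 : ℝ))⁻¹ * (1 + b⁻¹)), fun x => ?_⟩
  rw [fderiv_isotropicGaussianPDF, norm_smul, innerSL_apply_norm, norm_mul, norm_mul,
    Real.norm_of_nonneg (isotropicGaussianPDF_pos hb x).le, Real.norm_of_nonneg hb.le,
    isotropicGaussianPDF]
  -- The constant comes from `‖x‖ ≤ 1 + ‖x‖² ≤ (1 + b‖x‖²)(1 + b⁻¹)` and `1 + u ≤ exp u`.
  have h1 : Real.exp (-(b * ‖x‖ ^ 2)) * ‖x‖ ≤ 1 + b⁻¹ := by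
    rw [Real.exp_neg, inv_mul_le_iff₀ (Real.exp_pos _)]
    have h2 := Real.add_one_le_exp (b * ‖x‖ ^ 2)
    have h3 : ‖x‖ ≤ 1 + ‖x‖ ^ 2 := by nlinarith [sq_nonneg (‖x‖ - 1)]
    have h4 : (b * ‖x‖ ^ 2 + 1) * (1 + b⁻¹) = 1 + ‖x‖ ^ 2 + (b * ‖x‖ ^ 2 + b⁻¹) := by
      field_simp
      ring
    have h5 : 0 ≤ b * ‖x‖ ^ 2 + b⁻¹ := by positivity
    have h6 := mul_le_mul_of_nonneg_right h2 (by positivity : 0 ≤ 1 + b⁻¹)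
    linarith
  calc _ = 2 * b * (((Real.pi / b) ^ (d / 2 : ℝ))⁻¹ * (Real.exp (-(b * ‖x‖ ^ 2)) * ‖x‖)) := by
        rw [norm_neg, Real.norm_two, neg_mul]
        ring
    _ ≤ _ := by gcongr

theorem integral_isotropicGaussianPDF (hb : 0 < b) :
    ∫ x, isotropicGaussianPDF d b x = 1 := by
  unfold isotropicGaussianPDF
  rw [integral_const_mul, GaussianFourier.integral_rexp_neg_mul_sq_norm hb,
    finrank_euclideanSpace_fin]
  exact inv_mul_cancel₀ (by positivity)

theorem integrable_isotropicGaussianPDF (hb : 0 < b) :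
    Integrable (isotropicGaussianPDF d b) :=
  -- A function that is not integrable has Bochner integral `0` by convention.
  .of_integral_ne_zero (by rw [integral_isotropicGaussianPDF hb]; exact one_ne_zero)

theorem isProbabilityMeasure_withDensity_isotropicGaussianPDF (hb : 0 < b) :
    IsProbabilityMeasure ((volume : Measure (EuclideanSpace ℝ (Fin d))).withDensity
      fun x => ENNReal.ofReal (isotropicGaussianPDF d b x)) := by
  refine ⟨?_⟩
  rw [withDensity_apply _ MeasurableSet.univ, Measure.restrict_univ,
    ← ofReal_integral_eq_lintegral_ofReal (integrable_isotropicGaussianPDF hb)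
      (.of_forall fun x => (isotropicGaussianPDF_pos hb x).le),
    integral_isotropicGaussianPDF hb, ENNReal.ofReal_one]

theorem charFun_withDensity_isotropicGaussianPDF (hb : 0 < b) (t : EuclideanSpace ℝ (Fin d)) :
    charFun ((volume : Measure (EuclideanSpace ℝ (Fin d))).withDensity
      fun x => ENNReal.ofReal (isotropicGaussianPDF d b x)) t
      = Complex.exp (-(‖t‖ ^ 2 / (4 * b) : ℝ)) := by
  have hc : Continuous (isotropicGaussianPDF d b) := contDiff_isotropicGaussianPDF.continuous
  rw [charFun_apply, integral_withDensity_eq_integral_toReal_smul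
    (by fun_prop) (.of_forall fun x => ENNReal.ofReal_lt_top)]
  have h1 := GaussianFourier.integral_cexp_neg_mul_sq_norm_add (b := (b : ℂ)) (by simpa using hb)
    Complex.I t
  have h2 : ∀ x : EuclideanSpace ℝ (Fin d),
      (ENNReal.ofReal (isotropicGaussianPDF d b x)).toReal • Complex.exp (⟪x, t⟫ * Complex.I)
        = (((Real.pi / b) ^ (d / 2 : ℝ) : ℝ) : ℂ)⁻¹
          * Complex.exp (-b * ‖x‖ ^ 2 + Complex.I * ⟪t, x⟫) := fun x => by
    rw [ENNReal.toReal_ofReal (isotropicGaussianPDF_pos hb x).le, isotropicGaussianPDF,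
      Complex.real_smul, Complex.exp_add, real_inner_comm t x]
    push_cast
    ring_nf
  simp_rw [h2]
  rw [integral_const_mul, h1, finrank_euclideanSpace_fin, Complex.ofReal_cpow (by positivity)]
  push_cast
  rw [← mul_assoc, inv_mul_cancel₀, one_mul, Complex.I_sq]
  · congr 1
    ring
  · rw [← Complex.ofReal_div]
    have : ((d : ℂ) / 2) = ((d / 2 : ℝ) : ℂ) := by push_cast; rfl
    rw [this, ← Complex.ofReal_cpow (by positivity)]
    exact_mod_cast (by positivity : (0 : ℝ) < _).ne'

/-- The characteristic functions agree: `b = (2σ²)⁻¹` turns `‖t‖²/(4b)` into `σ²‖t‖²/2`. -/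
theorem multivariateGaussian_smul_one_eq_withDensity {σ : ℝ} (hσ : 0 < σ) :
    multivariateGaussian 0 (σ ^ 2 • (1 : Matrix (Fin d) (Fin d) ℝ))
      = volume.withDensity
        fun x => ENNReal.ofReal (isotropicGaussianPDF d (2 * σ ^ 2)⁻¹ x) := by
  have hb : 0 < (2 * σ ^ 2)⁻¹ := by positivity
  have := isProbabilityMeasure_withDensity_isotropicGaussianPDF (d := d) hb
  refine Measure.ext_of_charFun ?_
  ext t
  rw [charFun_withDensity_isotropicGaussianPDF hb,
    charFun_multivariateGaussian (Matrix.PosSemidef.one.smul (sq_nonneg σ))]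
  have h : t.ofLp ⬝ᵥ (σ ^ 2 • (1 : Matrix (Fin d) (Fin d) ℝ)).mulVec t.ofLp
      = σ ^ 2 * ‖t‖ ^ 2 := by
    rw [Matrix.smul_mulVec, Matrix.one_mulVec, dotProduct_smul, smul_eq_mul,
      EuclideanSpace.real_norm_sq_eq]
    simp [dotProduct, sq]
  rw [h, inner_zero_right]
  congr 1
  push_cast
  field_simp
  norm_num

end GaussianDensity

/-! ### Gaussian smoothing of a density and its score -/

section Smoothing

theorem gradient_log {d : ℕ} {q : EuclideanSpace ℝ (Fin d) → ℝ} (hqd : Differentiable ℝ q)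
    (hq0 : ∀ y, 0 < q y) (y : EuclideanSpace ℝ (Fin d)) : ∇ (fun z => Real.log (q z)) y = (q y)⁻¹ • ∇ q y := by
  rw [gradient, ((hqd y).hasFDerivAt.log (hq0 y).ne').fderiv, gradient, map_smul]

variable {d : ℕ} {b : ℝ} {p : EuclideanSpace ℝ (Fin d) → ℝ}
  {G : EuclideanSpace ℝ (Fin d) → EuclideanSpace ℝ (Fin d)}

/-- The convolution of `p` with the isotropic Gaussian density. -/
noncomputable def gaussianSmoothing (b : ℝ) (p : EuclideanSpace ℝ (Fin d) → ℝ)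
    (y : EuclideanSpace ℝ (Fin d)) : ℝ :=
  ∫ x, p x * isotropicGaussianPDF d b (y - x)

theorem aestronglyMeasurable_isotropicGaussianPDF_sub (y : EuclideanSpace ℝ (Fin d)) :
    AEStronglyMeasurable (fun x => isotropicGaussianPDF d b (y - x)) volume :=
  (contDiff_isotropicGaussianPDF.continuous.comp
    (continuous_const.sub continuous_id)).aestronglyMeasurable

theorem integrable_mul_isotropicGaussianPDF_sub (hb : 0 < b) (hp : Integrable p)
    (y : EuclideanSpace ℝ (Fin d)) :
    Integrable fun x => p x * isotropicGaussianPDF d b (y - x) :=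
  hp.mul_bdd (aestronglyMeasurable_isotropicGaussianPDF_sub y)
    (.of_forall fun x => isotropicGaussianPDF_le hb (y - x))

theorem integrable_gaussianSmoothing (hb : 0 < b) (hp : Integrable p) :
    Integrable (gaussianSmoothing b p) :=
  hp.integrable_convolution (ContinuousLinearMap.mul ℝ ℝ) (integrable_isotropicGaussianPDF hb)

theorem integral_gaussianSmoothing (hb : 0 < b) (hp : Integrable p) :
    ∫ y, gaussianSmoothing b p y = ∫ x, p x := by
  have := integral_convolution (ContinuousLinearMap.mul ℝ ℝ) (μ := volume) (ν := volume) hp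
    (integrable_isotropicGaussianPDF hb)
  rw [integral_isotropicGaussianPDF hb, ContinuousLinearMap.mul_apply', mul_one] at this
  exact this

/-- The derivative falls on the Gaussian, whose derivative is bounded, so integrability of `p` is
enough. -/
theorem hasFDerivAt_gaussianSmoothing (hb : 0 < b) (hp : Integrable p)
    (y : EuclideanSpace ℝ (Fin d)) :
    HasFDerivAt (gaussianSmoothing b p)
      (∫ x, p x • fderiv ℝ (isotropicGaussianPDF d b) (y - x)) y := by
  obtain ⟨M, hM⟩ := exists_norm_fderiv_isotropicGaussianPDF_le (d := d) hb
  have hd : Continuous (fderiv ℝ (isotropicGaussianPDF d b)) :=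
    contDiff_isotropicGaussianPDF.continuous_fderiv (by simp)
  refine hasFDerivAt_integral_of_dominated_of_fderiv_le (bound := fun x => ‖p x‖ * M)
    (F' := fun y x => p x • fderiv ℝ (isotropicGaussianPDF d b) (y - x)) Filter.univ_mem
    (.of_forall fun y => (integrable_mul_isotropicGaussianPDF_sub hb hp y).aestronglyMeasurable)
    (integrable_mul_isotropicGaussianPDF_sub hb hp y) ?_ (.of_forall fun x y _ => ?_)
    (hp.norm.mul_const M) (.of_forall fun x y _ => ?_)
  · exact hp.aestronglyMeasurable.smul
      (hd.comp (continuous_const.sub continuous_id)).aestronglyMeasurable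
  · rw [norm_smul]
    gcongr
    exact hM _
  · have h := (contDiff_isotropicGaussianPDF (d := d) (b := b)).differentiable (by simp) (y - x)
    exact (h.hasFDerivAt.comp y (hasFDerivAt_sub_const x)).const_mul (p x)

theorem differentiable_gaussianSmoothing (hb : 0 < b) (hp : Integrable p) :
    Differentiable ℝ (gaussianSmoothing b p) := fun y =>
  (hasFDerivAt_gaussianSmoothing hb hp y).differentiableAt

theorem gaussianSmoothing_pos (hb : 0 < b) (hp : Integrable p) (hp0 : ∀ x, 0 ≤ p x)
    (hp1 : ∫ x, p x = 1) (y : EuclideanSpace ℝ (Fin d)) : 0 < gaussianSmoothing b p y := by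
  have hg := isotropicGaussianPDF_pos (d := d) hb
  refine (integral_nonneg fun x => mul_nonneg (hp0 x) (hg _).le).lt_of_ne fun h => ?_
  have h0 := (integral_eq_zero_iff_of_nonneg (fun x => mul_nonneg (hp0 x) (hg _).le)
    (integrable_mul_isotropicGaussianPDF_sub hb hp y)).1 h.symm
  have : p =ᵐ[volume] 0 := by
    filter_upwards [h0] with x hx
    exact (mul_eq_zero.1 hx).resolve_right (hg _).ne'
  rw [integral_congr_ae this] at hp1
  simp at hp1

theorem withDensity_conv_withDensity_isotropicGaussianPDF (hb : 0 < b) (hp : Integrable p)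
    (hpm : Measurable p) (hp0 : ∀ x, 0 ≤ p x) :
    (volume.withDensity fun x => ENNReal.ofReal (p x)) ∗
        (volume.withDensity fun x => ENNReal.ofReal (isotropicGaussianPDF d b x))
      = volume.withDensity fun x => ENNReal.ofReal (gaussianSmoothing b p x) := by
  have hg := isotropicGaussianPDF_pos (d := d) hb
  have hgc : Continuous (isotropicGaussianPDF d b) := contDiff_isotropicGaussianPDF.continuous
  rw [conv_withDensity_eq_lconvolution (by fun_prop) (by fun_prop)]
  congr 1
  ext y
  rw [lconvolution_def, gaussianSmoothing, ofReal_integral_eq_lintegral_ofReal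
    (integrable_mul_isotropicGaussianPDF_sub hb hp y)
    (.of_forall fun x => mul_nonneg (hp0 x) (hg _).le)]
  refine lintegral_congr fun x => ?_
  rw [ENNReal.ofReal_mul (hp0 x), neg_add_eq_sub]

/-- Integration by parts moves the derivative from the Gaussian to `p`. The test function `x ↦ g (y
- x)` is not compactly supported, which is why the version for bounded test functions is needed. -/
theorem HasWeakGradient.gradient_gaussianSmoothing (h : HasWeakGradient p G) (hb : 0 < b)
    (hp : Integrable p) (hG : Integrable G) (y : EuclideanSpace ℝ (Fin d)) :
    ∇ (gaussianSmoothing b p) y = ∫ x, isotropicGaussianPDF d b (y - x) • G x := by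
  obtain ⟨M, hM⟩ := exists_norm_fderiv_isotropicGaussianPDF_le (d := d) hb
  have hd : Continuous (fderiv ℝ (isotropicGaussianPDF d b)) :=
    contDiff_isotropicGaussianPDF.continuous_fderiv (by simp)
  have hφ : ContDiff ℝ ∞ fun x => isotropicGaussianPDF d b (y - x) :=
    contDiff_isotropicGaussianPDF.comp (contDiff_const.sub contDiff_id)
  have hφd : ∀ x, fderiv ℝ (fun x => isotropicGaussianPDF d b (y - x)) x
      = -fderiv ℝ (isotropicGaussianPDF d b) (y - x) := fun x => by
    have h := (contDiff_isotropicGaussianPDF (d := d) (b := b)).differentiable (by simp) (y - x)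
    refine ((h.hasFDerivAt.comp x ((hasFDerivAt_id x).const_sub y)).congr_fderiv ?_).fderiv
    ext v
    simp
  have hint : Integrable fun x => p x • fderiv ℝ (isotropicGaussianPDF d b) (y - x) :=
    hp.smul_bdd M (hd.comp (continuous_const.sub continuous_id)).aestronglyMeasurable
      (.of_forall fun x => hM (y - x))
  have hint' : Integrable fun x => isotropicGaussianPDF d b (y - x) • G x :=
    hG.bdd_smul _ (aestronglyMeasurable_isotropicGaussianPDF_sub y)
      (.of_forall fun x => isotropicGaussianPDF_le hb (y - x))
  refine ext_inner_right ℝ fun z => ?_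
  rw [gradient, InnerProductSpace.toDual_symm_apply, (hasFDerivAt_gaussianSmoothing hb hp y).fderiv,
    ContinuousLinearMap.integral_apply hint, real_inner_comm, ← integral_inner hint']
  have key := h.integral_fderiv_mul_of_bounded hp hG hφ
    (fun x => isotropicGaussianPDF_le hb (y - x))
    (fun x => by rw [hφd, norm_neg]; exact hM (y - x)) z
  simp only [hφd, neg_apply, neg_mul, integral_neg, neg_inj] at key
  simp only [smul_apply, smul_eq_mul, inner_smul_right]
  simp only [mul_comm (p _), key, real_inner_comm]

/-- Pointwise Jensen for the posterior average of the score, without conditional expectations. With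
`c` the norm of the smoothed score at `y`, integrate `2c‖s‖ ≤ c² + ‖s‖²` against `p x * g (y - x)`.
The left side dominates `2c²q`, with `q` the smoothed density at `y`, and `c²q` cancels. -/
theorem HasWeakGradient.norm_gradient_log_gaussianSmoothing_sq_le (h : HasWeakGradient p G)
    (hb : 0 < b) (hp : Integrable p) (hp0 : ∀ x, 0 ≤ p x) (hp1 : ∫ x, p x = 1)
    (hG : Integrable G) (hGp : ∀ᵐ x, p x = 0 → G x = 0)
    (hS : Integrable fun x => ‖score p G x‖ ^ 2 * p x) (y : EuclideanSpace ℝ (Fin d)) :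
    ‖∇ (fun z => Real.log (gaussianSmoothing b p z)) y‖ ^ 2 * gaussianSmoothing b p y
      ≤ gaussianSmoothing b (fun x => ‖score p G x‖ ^ 2 * p x) y := by
  have hq := gaussianSmoothing_pos hb hp hp0 hp1 y
  have hlog := gradient_log (differentiable_gaussianSmoothing hb hp)
    (gaussianSmoothing_pos hb hp hp0 hp1) y
  set c := ‖∇ (fun z => Real.log (gaussianSmoothing b p z)) y‖ with hc
  have hcq : c * gaussianSmoothing b p y = ‖∇ (gaussianSmoothing b p) y‖ := by
    rw [hc, hlog, norm_smul, norm_inv, Real.norm_of_nonneg hq.le]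
    field_simp
  have hc0 : 0 ≤ c := norm_nonneg _
  have hg := isotropicGaussianPDF_pos (d := d) hb
  have h1 : 2 * c * ‖∇ (gaussianSmoothing b p) y‖
      ≤ ∫ x, (c ^ 2 * (p x * isotropicGaussianPDF d b (y - x))
        + ‖score p G x‖ ^ 2 * p x * isotropicGaussianPDF d b (y - x)) := by
    rw [h.gradient_gaussianSmoothing hb hp hG]
    refine (mul_le_mul_of_nonneg_left (norm_integral_le_integral_norm _) (by positivity)).trans ?_
    rw [← integral_const_mul]
    refine integral_mono_ae ?_ ?_ ?_
    · exact (hG.bdd_smul _ (aestronglyMeasurable_isotropicGaussianPDF_sub y)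
        (.of_forall fun x => isotropicGaussianPDF_le hb (y - x))).norm.const_mul _
    · exact ((integrable_mul_isotropicGaussianPDF_sub hb hp y).const_mul _).add
        (integrable_mul_isotropicGaussianPDF_sub hb hS y)
    · filter_upwards [hGp] with x hx
      have hGx : ‖G x‖ = ‖score p G x‖ * p x := by
        by_cases hpx : p x = 0
        · simp [hx hpx, hpx]
        · rw [score, norm_smul, norm_inv, Real.norm_of_nonneg (hp0 x)]
          field_simp
      rw [norm_smul, Real.norm_of_nonneg (hg _).le, hGx]
      nlinarith [mul_nonneg (mul_nonneg (hp0 x) (hg (y - x)).le) (sq_nonneg (c - ‖score p G x‖))]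
  rw [integral_add ((integrable_mul_isotropicGaussianPDF_sub hb hp y).const_mul _)
        (integrable_mul_isotropicGaussianPDF_sub hb hS y), integral_const_mul] at h1
  change _ ≤ c ^ 2 * gaussianSmoothing b p y
    + gaussianSmoothing b (fun x => ‖score p G x‖ ^ 2 * p x) y at h1
  rw [← hcq] at h1
  linarith

end Smoothing

/-! ### Taylor bounds and characteristic functions of displaced laws -/

section Estimates

/-- Compare derivatives along `u ↦ x u` on `[0, 1]`, using `|exp(iv) - 1| ≤ |v|`; this treats both
signs of `x` at once. -/
theorem norm_cexp_I_mul_sub_one_sub_le (x : ℝ) :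
    ‖Complex.exp (Complex.I * x) - 1 - Complex.I * x‖ ≤ x ^ 2 / 2 := by
  have hd : ∀ u : ℝ, HasDerivAt
      (fun u : ℝ => Complex.exp (Complex.I * (x * u : ℝ)) - 1 - Complex.I * (x * u : ℝ))
      (Complex.I * x * (Complex.exp (Complex.I * (x * u : ℝ)) - 1)) u := fun u => by
    have h1 : HasDerivAt (fun u : ℝ => Complex.I * ((x * u : ℝ) : ℂ)) (Complex.I * x) u := by
      simpa using (((hasDerivAt_id u).const_mul x).ofReal_comp).const_mul Complex.I
    exact ((h1.cexp.sub_const 1).sub h1).congr_deriv (by ring)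
  have hB : ∀ u : ℝ, HasDerivAt (fun u : ℝ => x ^ 2 * u ^ 2 / 2) (x ^ 2 * u) u := fun u =>
    ((((hasDerivAt_id u).pow 2).const_mul (x ^ 2)).div_const 2).congr_deriv (by simp; ring)
  have := image_norm_le_of_norm_deriv_right_le_deriv_boundary (a := 0) (b := 1)
    (fun u _ => (hd u).continuousAt.continuousWithinAt) (fun u _ => (hd u).hasDerivWithinAt)
    (by simp) hB (fun u hu => by
      rw [norm_mul, norm_mul, Complex.norm_I, one_mul, Complex.norm_real]
      refine (mul_le_mul_of_nonneg_left Real.norm_exp_I_mul_ofReal_sub_one_le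
        (norm_nonneg _)).trans_eq ?_
      rw [norm_mul, Real.norm_of_nonneg hu.1, ← mul_assoc, Real.norm_eq_abs, abs_mul_abs_self, sq])
    (Set.right_mem_Icc.2 zero_le_one)
  simpa using this

theorem abs_one_sub_exp_neg_le {t : ℝ} (ht : 0 ≤ t) : |1 - Real.exp (-t)| ≤ t := by
  rw [abs_of_nonneg (sub_nonneg.2 (Real.exp_le_one_iff.2 (by linarith)))]
  linarith [Real.add_one_le_exp (-t)]

/-- The derivative is `u exp(-u) ≤ u`: the terms linear in `t` cancel, which is the gain from `σ²`
to `σ⁴`. -/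
theorem abs_one_sub_one_add_mul_exp_neg_le {t : ℝ} (ht : 0 ≤ t) :
    |1 - (1 + t) * Real.exp (-t)| ≤ t ^ 2 / 2 := by
  have hd : ∀ u : ℝ, HasDerivAt (fun u : ℝ => 1 - (1 + u) * Real.exp (-u))
      (u * Real.exp (-u)) u := fun u => by
    have h1 := ((hasDerivAt_id u).const_add 1).mul ((hasDerivAt_id u).neg.exp)
    exact (h1.const_sub 1).congr_deriv (by simp; ring)
  have hB : ∀ u : ℝ, HasDerivAt (fun u : ℝ => u ^ 2 / 2) u u := fun u =>
    (((hasDerivAt_id u).pow 2).div_const 2).congr_deriv (by simp)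
  exact image_norm_le_of_norm_deriv_right_le_deriv_boundary (a := 0) (b := t)
    (fun u _ => (hd u).continuousAt.continuousWithinAt) (fun u _ => (hd u).hasDerivWithinAt)
    (by simp) hB (fun u hu => by
      rw [norm_mul, Real.norm_of_nonneg hu.1, Real.norm_of_nonneg (Real.exp_pos _).le]
      exact mul_le_of_le_one_right hu.1 (Real.exp_le_one_iff.2 (by linarith [hu.1])))
    (Set.right_mem_Icc.2 ht)

theorem sq_integral_norm_le {E : Type*} [NormedAddCommGroup E] [SecondCountableTopology E]
    [MeasurableSpace E] [BorelSpace E] {ν : Measure E} [IsProbabilityMeasure ν] {s : E → E} {C : ℝ} (hs2 : Integrable (fun y => ‖s y‖ ^ 2) ν) (hC : ∫ y, ‖s y‖ ^ 2 ∂ν ≤ C)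
    (hs : Measurable s) : (∫ y, ‖s y‖ ∂ν) ^ 2 ≤ C := by
  have hi : Integrable (fun y => ‖s y‖) ν :=
    ((memLp_two_iff_integrable_sq_norm hs.aestronglyMeasurable).2 hs2).integrable
      (by norm_num) |>.norm
  set m := ∫ y, ‖s y‖ ∂ν
  -- With `m` the mean of `‖s‖`, the left side is `2m²` and the right side is at most `m² + C`.
  have : ∫ y, (2 * m * ‖s y‖) ∂ν ≤ ∫ y, (m ^ 2 + ‖s y‖ ^ 2) ∂ν :=
    integral_mono (hi.const_mul _) ((integrable_const _).add hs2) fun y => by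
      simp only
      nlinarith [sq_nonneg (m - ‖s y‖)]
  rw [integral_const_mul, integral_add (integrable_const _) hs2] at this
  simp only [integral_const, probReal_univ, one_smul] at this
  nlinarith

variable {E : Type*} [NormedAddCommGroup E] [InnerProductSpace ℝ E] [SecondCountableTopology E]
  [MeasurableSpace E] [BorelSpace E] {ν : Measure E} [IsProbabilityMeasure ν] {s : E → E}

theorem charFun_map_add_smul_sub (hs : Measurable s) (a : ℝ) (ξ : E) :
    charFun (ν.map fun y => y + a • s y) ξ - charFun ν ξ
      = ∫ y, Complex.exp (⟪y, ξ⟫ * Complex.I)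
          * (Complex.exp (Complex.I * (a * ⟪s y, ξ⟫ : ℝ)) - 1) ∂ν := by
  have hT : Measurable fun y => y + a • s y := by fun_prop
  have hb : ∀ {f : E → ℝ}, Measurable f →
      Integrable (fun y => Complex.exp (f y * Complex.I)) ν := fun hf =>
    .of_bound (C := 1) (by fun_prop : Measurable _).aestronglyMeasurable
      (.of_forall fun y => by rw [Complex.norm_exp_ofReal_mul_I])
  rw [charFun_apply, charFun_apply,
    integral_map hT.aemeasurable (by fun_prop : Continuous _).aestronglyMeasurable,
    ← integral_sub (hb (f := fun y => ⟪y + a • s y, ξ⟫) (by fun_prop)) (hb (by fun_prop))]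
  refine integral_congr_ae (.of_forall fun y => ?_)
  simp only
  rw [mul_sub, mul_one, ← Complex.exp_add, inner_add_left, real_inner_smul_left]
  push_cast
  ring_nf

theorem norm_charFun_map_add_smul_sub_le {C : ℝ} (hs : Measurable s)
    (hs2 : Integrable (fun y => ‖s y‖ ^ 2) ν) (hC : ∫ y, ‖s y‖ ^ 2 ∂ν ≤ C) (a : ℝ) (ξ : E) :
    ‖charFun (ν.map fun y => y + a • s y) ξ - charFun ν ξ‖ ≤ |a| * ‖ξ‖ * √C := by
  have hi : Integrable (fun y => ‖s y‖) ν :=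
    ((memLp_two_iff_integrable_sq_norm hs.aestronglyMeasurable).2 hs2).integrable
      (by norm_num) |>.norm
  rw [charFun_map_add_smul_sub hs]
  calc _ ≤ ∫ y, |a| * ‖ξ‖ * ‖s y‖ ∂ν := by
        refine norm_integral_le_of_norm_le (hi.const_mul _) (.of_forall fun y => ?_)
        rw [norm_mul, Complex.norm_exp_ofReal_mul_I, one_mul]
        refine Real.norm_exp_I_mul_ofReal_sub_one_le.trans ?_
        rw [norm_mul, Real.norm_eq_abs, mul_assoc, mul_comm ‖ξ‖]
        gcongr
        exact norm_inner_le_norm _ _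
    _ = |a| * ‖ξ‖ * ∫ y, ‖s y‖ ∂ν := integral_const_mul _ _
    _ ≤ _ := by
        gcongr
        exact Real.le_sqrt_of_sq_le (sq_integral_norm_le hs2 hC hs)

/-- Second-order expansion of the displacement. The linear term stays exact because integration by
parts will evaluate it. -/
theorem norm_charFun_map_add_smul_sub_sub_le {C : ℝ} (hs : Measurable s)
    (hs2 : Integrable (fun y => ‖s y‖ ^ 2) ν) (hC : ∫ y, ‖s y‖ ^ 2 ∂ν ≤ C) (a : ℝ) (ξ : E) :
    ‖charFun (ν.map fun y => y + a • s y) ξ - charFun ν ξ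
        - Complex.I * a * ∫ y, Complex.exp (⟪y, ξ⟫ * Complex.I) * (⟪s y, ξ⟫ : ℝ) ∂ν‖
      ≤ a ^ 2 * ‖ξ‖ ^ 2 / 2 * C := by
  have hi : Integrable s ν :=
    ((memLp_two_iff_integrable_sq_norm hs.aestronglyMeasurable).2 hs2).integrable (by norm_num)
  have h1 : Integrable (fun y => Complex.exp (⟪y, ξ⟫ * Complex.I)
          * (Complex.exp (Complex.I * (a * ⟪s y, ξ⟫ : ℝ)) - 1)) ν := by
    refine .of_bound (C := 2) (by fun_prop : Measurable _).aestronglyMeasurable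
      (.of_forall fun y => ?_)
    rw [norm_mul, Complex.norm_exp_ofReal_mul_I, one_mul]
    refine (norm_sub_le _ _).trans ?_
    rw [Complex.norm_exp_I_mul_ofReal, norm_one]
    norm_num
  have h2 : Integrable (fun y => Complex.exp (⟪y, ξ⟫ * Complex.I) * (⟪s y, ξ⟫ : ℝ)) ν :=
    (hi.inner_const ξ).ofReal.bdd_mul (c := 1) (by fun_prop : Measurable _).aestronglyMeasurable
      (.of_forall fun y => by rw [Complex.norm_exp_ofReal_mul_I])
  rw [charFun_map_add_smul_sub hs, ← integral_const_mul, ← integral_sub h1 (h2.const_mul _)]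
  calc _ ≤ ∫ y, a ^ 2 * ‖ξ‖ ^ 2 / 2 * ‖s y‖ ^ 2 ∂ν := by
        refine norm_integral_le_of_norm_le (hs2.const_mul _) (.of_forall fun y => ?_)
        have : Complex.exp (⟪y, ξ⟫ * Complex.I) * (Complex.exp (Complex.I * (a * ⟪s y, ξ⟫ : ℝ)) - 1)
            - Complex.I * a * (Complex.exp (⟪y, ξ⟫ * Complex.I) * (⟪s y, ξ⟫ : ℝ))
            = Complex.exp (⟪y, ξ⟫ * Complex.I) * (Complex.exp (Complex.I * (a * ⟪s y, ξ⟫ : ℝ)) - 1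
              - Complex.I * (a * ⟪s y, ξ⟫ : ℝ)) := by
          push_cast
          ring
        rw [this, norm_mul, Complex.norm_exp_ofReal_mul_I, one_mul]
        refine (norm_cexp_I_mul_sub_one_sub_le _).trans ?_
        have h : ⟪s y, ξ⟫ ^ 2 ≤ (‖s y‖ * ‖ξ‖) ^ 2 := by
          rw [← sq_abs]
          gcongr
          exact abs_real_inner_le_norm _ _
        calc _ = a ^ 2 / 2 * ⟪s y, ξ⟫ ^ 2 := by ring
          _ ≤ a ^ 2 / 2 * (‖s y‖ * ‖ξ‖) ^ 2 := by gcongr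
          _ = _ := by ring
    _ = a ^ 2 * ‖ξ‖ ^ 2 / 2 * ∫ y, ‖s y‖ ^ 2 ∂ν := integral_const_mul _ _
    _ ≤ _ := by gcongr

end Estimates

/-! ### Integration by parts for the score -/

section Stein

variable {d : ℕ} {q : EuclideanSpace ℝ (Fin d) → ℝ}

theorem measurable_gradient (f : EuclideanSpace ℝ (Fin d) → ℝ) : Measurable (∇ f) :=
  (InnerProductSpace.toDual ℝ _).symm.continuous.measurable.comp (measurable_fderiv ℝ f)

/-- Integration by parts of the score against a character. -/
theorem integral_cexp_mul_inner_gradient_log (hqd : Differentiable ℝ q) (hq0 : ∀ y, 0 < q y)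
    (hqi : Integrable q)
    (hs : Integrable (∇ fun z => Real.log (q z))
      (volume.withDensity fun y => ENNReal.ofReal (q y)))
    (ξ : EuclideanSpace ℝ (Fin d)) :
    ∫ y, Complex.exp (⟪y, ξ⟫ * Complex.I) * (⟪∇ (fun z => Real.log (q z)) y, ξ⟫ : ℝ)
        ∂(volume.withDensity fun y => ENNReal.ofReal (q y))
      = -(Complex.I * ‖ξ‖ ^ 2) * charFun (volume.withDensity fun y => ENNReal.ofReal (q y)) ξ := by
  have hm : Measurable fun y => ENNReal.ofReal (q y) := hqd.continuous.measurable.ennreal_ofReal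
  have hlt : ∀ᵐ y : EuclideanSpace ℝ (Fin d), ENNReal.ofReal (q y) < ⊤ :=
    .of_forall fun y => ENNReal.ofReal_lt_top
  set e : EuclideanSpace ℝ (Fin d) → ℂ := fun y => Complex.exp (⟪y, ξ⟫ * Complex.I) with he
  set g : EuclideanSpace ℝ (Fin d) → ℂ := fun y => (q y : ℂ) with hg
  have hed : ∀ y, HasFDerivAt e ((e y * Complex.I) • Complex.ofRealCLM.comp (innerSL ℝ ξ)) y :=
    fun y => by
      have h1 : HasFDerivAt (fun y => ((⟪y, ξ⟫ : ℝ) : ℂ)) (Complex.ofRealCLM.comp (innerSL ℝ ξ)) y := by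
        have := (Complex.ofRealCLM.comp (innerSL ℝ ξ)).hasFDerivAt (x := y)
        refine this.congr_of_eventuallyEq (.of_forall fun z => ?_)
        simp [real_inner_comm]
      refine (h1.mul_const Complex.I).cexp.congr_fderiv ?_
      ext v
      simp [he]
      ring
  have hgd : ∀ y, HasFDerivAt g (Complex.ofRealCLM.comp (fderiv ℝ q y)) y := fun y =>
    Complex.ofRealCLM.hasFDerivAt.comp y (hqd y).hasFDerivAt
  have hen : ∀ y, ‖e y‖ ≤ 1 := fun y => (Complex.norm_exp_ofReal_mul_I _).le
  have hem : AEStronglyMeasurable e volume :=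
    (by fun_prop : Continuous e).aestronglyMeasurable
  have hfd : ∀ y, fderiv ℝ q y ξ = q y * ⟪∇ (fun z => Real.log (q z)) y, ξ⟫ := fun y => by
    rw [gradient_log hqd hq0, real_inner_smul_left, gradient, InnerProductSpace.toDual_symm_apply,
      mul_inv_cancel_left₀ (hq0 y).ne']
  have hgi : Integrable g := hqi.ofReal
  have hgi' : Integrable fun y => fderiv ℝ g y ξ := by
    have := (integrable_withDensity_iff_integrable_smul' hm hlt).1 (hs.inner_const (𝕜 := ℝ) ξ)
    refine this.ofReal.congr (.of_forall fun y => ?_)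
    simp [(hgd y).fderiv, hfd, ENNReal.toReal_ofReal (hq0 y).le]
  -- Differentiate in the direction `ξ` itself: the character `e` gains the factor `i‖ξ‖²`, and the
  -- derivative of `q` is `q` times the score component along `ξ`. Integrability of the three
  -- products removes boundary terms.
  have key := integral_smul_fderiv_eq_neg_fderiv_smul_of_integrable (μ := volume) (𝕜 := ℂ)
    (f := e) (g := g) (v := ξ) ?_ ?_ ?_ (fun y _ => (hed y).differentiableAt)
    (fun y _ => (hgd y).differentiableAt)
  · rw [charFun_apply, integral_withDensity_eq_integral_toReal_smul hm hlt,
      integral_withDensity_eq_integral_toReal_smul hm hlt, neg_mul, ← integral_const_mul]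
    calc _ = ∫ y, e y • fderiv ℝ g y ξ := integral_congr_ae (.of_forall fun y => by
            simp only
            rw [(hgd y).fderiv, ENNReal.toReal_ofReal (hq0 y).le]
            simp [hfd, he]
            ring)
      _ = _ := key
      _ = _ := congrArg _ (integral_congr_ae (.of_forall fun y => by
            simp only
            rw [(hed y).fderiv, ENNReal.toReal_ofReal (hq0 y).le]
            simp [he, hg]
            ring))
  · have : Integrable fun y => (Complex.I * ‖ξ‖ ^ 2) * (e y * g y) :=
      (hgi.bdd_mul hem (.of_forall hen)).const_mul _
    refine this.congr (.of_forall fun y => ?_)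
    simp only
    rw [(hed y).fderiv]
    simp
    ring
  · exact hgi'.bdd_mul hem (.of_forall hen)
  · exact hgi.bdd_mul hem (.of_forall hen)

end Stein

/-! ### Integrability of the score and Fisher information -/

section Score

variable {d : ℕ} {p : EuclideanSpace ℝ (Fin d) → ℝ}
  {G : EuclideanSpace ℝ (Fin d) → EuclideanSpace ℝ (Fin d)}

theorem integrable_of_isProbabilityMeasure_withDensity (hpm : Measurable p) (hp0 : ∀ x, 0 ≤ p x)
    (h : IsProbabilityMeasure ((volume : Measure (EuclideanSpace ℝ (Fin d))).withDensity
      fun x => ENNReal.ofReal (p x))) :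
    Integrable p ∧ ∫ x, p x = 1 := by
  have h1 := h.measure_univ
  rw [withDensity_apply _ MeasurableSet.univ, Measure.restrict_univ] at h1
  have hi : Integrable p := ⟨hpm.aestronglyMeasurable, by
    rw [hasFiniteIntegral_iff_ofReal (.of_forall hp0), h1]
    exact ENNReal.one_lt_top⟩
  refine ⟨hi, ?_⟩
  rw [integral_eq_lintegral_of_nonneg_ae (.of_forall hp0) hpm.aestronglyMeasurable, h1,
    ENNReal.toReal_one]

/-- If the score is square integrable under the law of density `p`, then the weak gradient of `p`
is integrable. -/
theorem HasWeakGradient.integrable_of_score (h : HasWeakGradient p G) (hp : Integrable p)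
    (hpm : Measurable p) (hp0 : ∀ x, 0 ≤ p x)
    (hS : Integrable fun x => ‖score p G x‖ ^ 2 * p x) : Integrable G := by
  -- Where `p > 0`, `‖G‖ = ‖score‖ p ≤ (‖score‖² + 1) p`; elsewhere `G` vanishes a.e.
  refine (hS.add hp).mono' h.locallyIntegrable_grad.aestronglyMeasurable ?_
  filter_upwards [h.ae_eq_zero_of_eq_zero hp hpm hp0] with x hx
  by_cases hpx : p x = 0
  · simp [hx hpx, hpx]
  · have hGx : ‖G x‖ = ‖score p G x‖ * p x := by
      rw [score, norm_smul, norm_inv, Real.norm_of_nonneg (hp0 x)]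
      field_simp
    rw [hGx, Pi.add_apply]
    nlinarith [mul_nonneg (hp0 x) (sq_nonneg (‖score p G x‖ - 1)),
      mul_nonneg (hp0 x) (sq_nonneg ‖score p G x‖), hp0 x]

/-- Gaussian smoothing does not increase the Fisher information. -/
theorem HasWeakGradient.integral_norm_gradient_log_gaussianSmoothing_sq_le
    (h : HasWeakGradient p G) {b : ℝ} (hb : 0 < b) (hp : Integrable p) (hpm : Measurable p)
    (hp0 : ∀ x, 0 ≤ p x) (hp1 : ∫ x, p x = 1)
    (hS : Integrable fun x => ‖score p G x‖ ^ 2 * p x) :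
    Integrable (fun y => ‖∇ (fun z => Real.log (gaussianSmoothing b p z)) y‖ ^ 2)
        (volume.withDensity fun y => ENNReal.ofReal (gaussianSmoothing b p y)) ∧
      ∫ y, ‖∇ (fun z => Real.log (gaussianSmoothing b p z)) y‖ ^ 2
          ∂(volume.withDensity fun y => ENNReal.ofReal (gaussianSmoothing b p y))
        ≤ ∫ x, ‖score p G x‖ ^ 2 * p x := by
  have hG := h.integrable_of_score hp hpm hp0 hS
  have hq0 := gaussianSmoothing_pos hb hp hp0 hp1
  have hqm : Measurable (gaussianSmoothing b p) :=
    (differentiable_gaussianSmoothing hb hp).continuous.measurable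
  have hlt : ∀ᵐ y : EuclideanSpace ℝ (Fin d), ENNReal.ofReal (gaussianSmoothing b p y) < ⊤ :=
    .of_forall fun y => ENNReal.ofReal_lt_top
  have hle := h.norm_gradient_log_gaussianSmoothing_sq_le hb hp hp0 hp1 hG
    (h.ae_eq_zero_of_eq_zero hp hpm hp0) hS
  have hm : Measurable fun y => ‖∇ (fun z => Real.log (gaussianSmoothing b p z)) y‖ ^ 2 :=
    (measurable_gradient _).norm.pow_const 2
  have hr := integrable_gaussianSmoothing hb hS
  have hi : Integrable fun y => ‖∇ (fun z => Real.log (gaussianSmoothing b p z)) y‖ ^ 2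
      * gaussianSmoothing b p y := by
    refine hr.mono' (hm.mul hqm).aestronglyMeasurable (.of_forall fun y => ?_)
    rw [Real.norm_of_nonneg (mul_nonneg (sq_nonneg _) (hq0 y).le)]
    exact hle y
  have hsm : ∀ y, (ENNReal.ofReal (gaussianSmoothing b p y)).toReal
      • ‖∇ (fun z => Real.log (gaussianSmoothing b p z)) y‖ ^ 2
      = ‖∇ (fun z => Real.log (gaussianSmoothing b p z)) y‖ ^ 2 * gaussianSmoothing b p y :=
    fun y => by rw [ENNReal.toReal_ofReal (hq0 y).le, smul_eq_mul, mul_comm]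
  refine ⟨(integrable_withDensity_iff_integrable_smul' hqm.ennreal_ofReal hlt).2 ?_, ?_⟩
  · simpa only [hsm] using hi
  · rw [integral_withDensity_eq_integral_toReal_smul hqm.ennreal_ofReal hlt,
      ← integral_gaussianSmoothing hb hS]
    simp only [hsm]
    exact integral_mono hi hr hle

theorem integrable_score_sq_mul_of_hasDensity {Ω : Type*} [MeasurableSpace Ω] {P : Measure Ω}
    {X : Ω → EuclideanSpace ℝ (Fin d)} (hX : HasDensity X p P) (h : HasWeakGradient p G)
    (hint : Integrable (fun w => ‖score p G (X w)‖ ^ 2) P) :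
    Integrable (fun x => ‖score p G x‖ ^ 2 * p x) ∧
      ∫ x, ‖score p G x‖ ^ 2 * p x = ∫ w, ‖score p G (X w)‖ ^ 2 ∂P := by
  have hm : Measurable fun x => ENNReal.ofReal (p x) := hX.measurable.ennreal_ofReal
  have hlt : ∀ᵐ x : EuclideanSpace ℝ (Fin d), ENNReal.ofReal (p x) < ⊤ :=
    .of_forall fun y => ENNReal.ofReal_lt_top
  have hs : AEStronglyMeasurable (fun x => ‖score p G x‖ ^ 2) (P.map X) := by
    rw [hX.hasLaw.map_eq]
    -- `G` is only a.e. strongly measurable for Lebesgue measure; absolute continuity transfers this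
    -- to the law of `X`.
    refine AEStronglyMeasurable.mono_ac (withDensity_absolutelyContinuous _ _) ?_
    exact (hX.measurable.inv.aestronglyMeasurable.smul
      h.locallyIntegrable_grad.aestronglyMeasurable).norm.pow 2
  have hsm : ∀ x, (ENNReal.ofReal (p x)).toReal • ‖score p G x‖ ^ 2
      = ‖score p G x‖ ^ 2 * p x := fun x => by
    rw [ENNReal.toReal_ofReal (hX.nonneg x), smul_eq_mul, mul_comm]
  constructor
  · have := (integrable_map_measure hs hX.hasLaw.aemeasurable).2 hint
    rw [hX.hasLaw.map_eq, integrable_withDensity_iff_integrable_smul' hm hlt] at this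
    simpa only [hsm] using this
  · have := integral_map hX.hasLaw.aemeasurable hs
    rw [hX.hasLaw.map_eq, integral_withDensity_eq_integral_toReal_smul hm hlt] at this
    simpa only [hsm] using this

end Score

/-! ### Comparison of `X` with the denoised observation -/

section Denoising

variable {d : ℕ} {Ω : Type*} [MeasurableSpace Ω] {P : Measure Ω} [IsProbabilityMeasure P]
  {X ε Y : Ω → EuclideanSpace ℝ (Fin d)} {σ : ℝ} {pX pY : EuclideanSpace ℝ (Fin d) → ℝ}

/-- The continuous density of `X + ε` is the Gaussian smoothing of the density of `X`. -/
theorem HasDensity.eq_gaussianSmoothing (hσ : 0 < σ)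
    (hε : HasLaw ε (multivariateGaussian 0 (σ ^ 2 • (1 : Matrix (Fin d) (Fin d) ℝ))) P)
    (hind : IndepFun X ε P) (hY : ∀ w, Y w = X w + ε w) (hpX : HasDensity X pX P)
    (hpY : HasDensity Y pY P) (hpYc : Continuous pY) :
    pY = gaussianSmoothing (2 * σ ^ 2)⁻¹ pX := by
  have hb : 0 < (2 * σ ^ 2)⁻¹ := by positivity
  have hprob := hpX.hasLaw.isProbabilityMeasure_iff.1 ‹_›
  obtain ⟨hp, hp1⟩ :=
    integrable_of_isProbabilityMeasure_withDensity hpX.measurable hpX.nonneg hprob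
  have hlaw := hind.hasLaw_fun_add hpX.hasLaw hε
  rw [multivariateGaussian_smul_one_eq_withDensity hσ,
    withDensity_conv_withDensity_isotropicGaussianPDF hb hp hpX.measurable hpX.nonneg,
    ← funext hY] at hlaw
  have hqc : Continuous (gaussianSmoothing (2 * σ ^ 2)⁻¹ pX) :=
    (differentiable_gaussianSmoothing hb hp).continuous
  have heq := hpY.hasLaw.map_eq.symm.trans hlaw.map_eq
  have hprobY := hpY.hasLaw.isProbabilityMeasure_iff.1 ‹_›
  rw [withDensity_eq_iff hpYc.measurable.ennreal_ofReal.aemeasurable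
    hqc.measurable.ennreal_ofReal.aemeasurable] at heq
  -- Densities of one law agree a.e.; continuity makes them equal everywhere, as needed to identify
  -- the gradients of their logarithms pointwise.
  · refine (Continuous.ae_eq_iff_eq volume hpYc hqc).1 ?_
    filter_upwards [heq] with y hy
    exact (ENNReal.ofReal_eq_ofReal_iff (hpY.nonneg y)
      (gaussianSmoothing_pos hb hp hpX.nonneg hp1 y).le).1 hy
  · have := hprobY.measure_univ
    rw [withDensity_apply _ MeasurableSet.univ, Measure.restrict_univ] at this
    rw [this]
    exact ENNReal.one_ne_top

theorem charFun_map_add_gaussian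
    (hε : HasLaw ε (multivariateGaussian 0 (σ ^ 2 • (1 : Matrix (Fin d) (Fin d) ℝ))) P)
    (hX : AEMeasurable X P) (hσ : 0 < σ)
    (hind : IndepFun X ε P) (hY : ∀ w, Y w = X w + ε w) (ξ : EuclideanSpace ℝ (Fin d)) :
    charFun (P.map Y) ξ = Real.exp (-(σ ^ 2 * ‖ξ‖ ^ 2 / 2)) * charFun (P.map X) ξ := by
  have hb : 0 < (2 * σ ^ 2)⁻¹ := by positivity
  have h := hind.charFun_map_add_eq_mul hX hε.aemeasurable
  have hYe : Y = X + ε := funext hY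
  rw [hYe, h, Pi.mul_apply, mul_comm, hε.map_eq, multivariateGaussian_smul_one_eq_withDensity hσ,
    charFun_withDensity_isotropicGaussianPDF hb, Complex.ofReal_exp]
  congr 3
  push_cast
  field_simp
  norm_num

variable {gradX : EuclideanSpace ℝ (Fin d) → EuclideanSpace ℝ (Fin d)} {C : ℝ}

/-- Each bound adds the error of the Gaussian factor `exp(-t)` to that of the displacement, expanded
to first order for general `α` and to second order for `α = 1/2`. -/
theorem norm_charFun_sub_charFun_denoiser_le (hσ : 0 < σ)
    (hε : HasLaw ε (multivariateGaussian 0 (σ ^ 2 • (1 : Matrix (Fin d) (Fin d) ℝ))) P)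
    (hind : IndepFun X ε P) (hY : ∀ w, Y w = X w + ε w) (hpX : HasDensity X pX P)
    (hgradX : HasWeakGradient pX gradX) (hpY : HasDensity Y pY P) (hpYc : Continuous pY)
    (hint : Integrable (fun w => ‖score pX gradX (X w)‖ ^ 2) P)
    (hC : ∫ w, ‖score pX gradX (X w)‖ ^ 2 ∂P ≤ C) (ξ : EuclideanSpace ℝ (Fin d)) :
    (∀ α : ℝ, ‖charFun (P.map X) ξ - charFun (P.map fun w => denoiser pY σ α (Y w)) ξ‖
        ≤ σ ^ 2 * ‖ξ‖ ^ 2 / 2 + |α * σ ^ 2| * ‖ξ‖ * √C) ∧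
      ‖charFun (P.map X) ξ - charFun (P.map fun w => denoiser pY σ (1 / 2) (Y w)) ξ‖
        ≤ (σ ^ 2 * ‖ξ‖ ^ 2 / 2) ^ 2 / 2 + (1 / 2 * σ ^ 2) ^ 2 * ‖ξ‖ ^ 2 / 2 * C := by
  have hb : 0 < (2 * σ ^ 2)⁻¹ := by positivity
  have hprob := hpX.hasLaw.isProbabilityMeasure_iff.1 ‹_›
  obtain ⟨hp, hp1⟩ :=
    integrable_of_isProbabilityMeasure_withDensity hpX.measurable hpX.nonneg hprob
  have hpYq := hpX.eq_gaussianSmoothing hσ hε hind hY hpY hpYc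
  obtain ⟨hS, hSC⟩ := integrable_score_sq_mul_of_hasDensity hpX hgradX hint
  obtain ⟨hs2, hs2C⟩ := hgradX.integral_norm_gradient_log_gaussianSmoothing_sq_le hb hp
    hpX.measurable hpX.nonneg hp1 hS
  have hq0 := gaussianSmoothing_pos hb hp hpX.nonneg hp1
  have hqd := differentiable_gaussianSmoothing hb hp
  have hqi := integrable_gaussianSmoothing hb hp
  rw [← hpYq] at hs2 hs2C hq0 hqd hqi
  replace hs2C := (hs2C.trans_eq hSC).trans hC
  have hlaw := hpY.hasLaw.map_eq
  rw [← hlaw] at hs2 hs2C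
  set s : EuclideanSpace ℝ (Fin d) → EuclideanSpace ℝ (Fin d) := ∇ fun z => Real.log (pY z) with hs
  have hsm : Measurable s := measurable_gradient _
  have hYm : AEMeasurable Y P := hpY.hasLaw.aemeasurable
  have : IsProbabilityMeasure (P.map Y) := Measure.isProbabilityMeasure_map hYm
  have : IsProbabilityMeasure (P.map X) :=
    Measure.isProbabilityMeasure_map hpX.hasLaw.aemeasurable
  have hsi : Integrable s (P.map Y) :=
    ((memLp_two_iff_integrable_sq_norm hsm.aestronglyMeasurable).2 hs2).integrable (by norm_num)
  have hmap : ∀ α : ℝ, (P.map fun w => denoiser pY σ α (Y w))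
      = (P.map Y).map fun y => y + (α * σ ^ 2) • s y := fun α => by
    rw [AEMeasurable.map_map_of_aemeasurable (by fun_prop) hYm]
    rfl
  have hcf := charFun_map_add_gaussian hε hpX.hasLaw.aemeasurable hσ hind hY ξ
  have ht : 0 ≤ σ ^ 2 * ‖ξ‖ ^ 2 / 2 := by positivity
  set t := σ ^ 2 * ‖ξ‖ ^ 2 / 2 with htd
  have hscale : ∀ r B : ℝ, |1 - r| ≤ B → ‖charFun (P.map X) ξ - r * charFun (P.map X) ξ‖ ≤ B :=
    fun r B h => by
      have : charFun (P.map X) ξ - r * charFun (P.map X) ξ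
          = ((1 - r : ℝ) : ℂ) * charFun (P.map X) ξ := by
        push_cast
        ring
      rw [this, norm_mul, Complex.norm_real, Real.norm_eq_abs]
      exact (mul_le_of_le_one_right (abs_nonneg _) (norm_charFun_le_one ξ)).trans h
  constructor
  · intro α
    have h1 := hscale _ _ (abs_one_sub_exp_neg_le ht)
    rw [← hcf] at h1
    have h2 := norm_charFun_map_add_smul_sub_le hsm hs2 hs2C (α * σ ^ 2) ξ
    rw [hmap, ← sub_add_sub_cancel _ (charFun (P.map Y) ξ)]
    rw [norm_sub_rev] at h2
    exact (norm_add_le _ _).trans (add_le_add h1 h2)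
  · have h1 := hscale _ _ (abs_one_sub_one_add_mul_exp_neg_le ht)
    have h2 := norm_charFun_map_add_smul_sub_sub_le hsm hs2 hs2C (1 / 2 * σ ^ 2) ξ
    have h3 : ∫ y, Complex.exp (⟪y, ξ⟫ * Complex.I) * (⟪s y, ξ⟫ : ℝ) ∂(P.map Y)
        = -(Complex.I * ‖ξ‖ ^ 2) * charFun (P.map Y) ξ := by
      rw [hlaw] at hsi ⊢
      exact integral_cexp_mul_inner_gradient_log hqd hq0 hqi hsi ξ
    -- This is where `α = 1/2` matters: the linear term is `t φ_Y`, which compensates the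
    -- first-order loss in `exp(-t)`.
    have h4 : Complex.I * ((1 / 2 * σ ^ 2 : ℝ) : ℂ)
        * (-(Complex.I * ‖ξ‖ ^ 2) * charFun (P.map Y) ξ) = t * charFun (P.map Y) ξ := by
      rw [htd]
      push_cast
      linear_combination (-(1 / 2 : ℂ) * σ ^ 2 * ‖ξ‖ ^ 2 * charFun (P.map Y) ξ) * Complex.I_sq
    rw [h3, h4] at h2
    rw [hmap]
    have h5 : charFun (P.map X) ξ
          - charFun ((P.map Y).map fun y => y + (1 / 2 * σ ^ 2) • s y) ξ
        = (charFun (P.map X) ξ - ((1 + t) * Real.exp (-t) : ℝ) * charFun (P.map X) ξ)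
          - (charFun ((P.map Y).map fun y => y + (1 / 2 * σ ^ 2) • s y) ξ - charFun (P.map Y) ξ
            - t * charFun (P.map Y) ξ) := by
      rw [hcf]
      push_cast
      ring
    rw [h5]
    exact (norm_sub_le _ _).trans (add_le_add h1 h2)

end Denoising

/-! ### Integration against the spectral measure -/

theorem corollary1 {d : ℕ} {Ω : Type*} [MeasurableSpace Ω] (P : Measure Ω) [IsProbabilityMeasure P]
    -- the data `X`, the noise `ε`, and the noisy observation `Y = X + ε`
    (X ε Y : Ω → EuclideanSpace ℝ (Fin d)) (σ : ℝ) (hσ : 0 < σ)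
    (hε : HasLaw ε (multivariateGaussian 0 (σ ^ 2 • (1 : Matrix (Fin d) (Fin d) ℝ))) P)
    (hind : IndepFun X ε P) (hY : ∀ w, Y w = X w + ε w)
    -- the density of `X`, with its gradient, and the continuous density of `Y`
    (pX : EuclideanSpace ℝ (Fin d) → ℝ) (hpX : HasDensity X pX P)
    (gradX : EuclideanSpace ℝ (Fin d) → EuclideanSpace ℝ (Fin d))
    (hgradX : HasWeakGradient pX gradX)
    (pY : EuclideanSpace ℝ (Fin d) → ℝ) (hpY : HasDensity Y pY P) (hpYc : Continuous pY)
    -- `E[‖∇ log p_X(X)‖²] ≤ C`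
    (C : ℝ) (hint : Integrable (fun w => ‖score pX gradX (X w)‖ ^ 2) P)
    (hC : ∫ w, ‖score pX gradX (X w)‖ ^ 2 ∂P ≤ C)
    -- the reproducing kernel Hilbert space of a translation-invariant kernel `ψ (x - y)`
    {H : Type*} [NormedAddCommGroup H] [InnerProductSpace ℝ H] [CompleteSpace H]
    [RKHS ℝ H (EuclideanSpace ℝ (Fin d)) ℝ]
    (ψ : EuclideanSpace ℝ (Fin d) → ℝ) (hψ : ∀ x y, RKHS.kernel H x y 1 = ψ (x - y))
    -- the spectral measure of `ψ`, and its moments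
    (Λ : Measure (EuclideanSpace ℝ (Fin d))) [IsFiniteMeasure Λ]
    (hΛ : ∀ x, (ψ x : ℂ) = ∫ ξ, Complex.exp (-(Complex.I * (⟪ξ, x⟫ : ℝ))) ∂Λ)
    (h2 : Integrable (fun ξ => ‖ξ‖ ^ 2) Λ) (h4 : Integrable (fun ξ => ‖ξ‖ ^ 4) Λ)
    (h8 : Integrable (fun ξ => ‖ξ‖ ^ 8) Λ)
    (C₂ C₄ C₈ : ℝ) (hC₂ : C₂ = ∫ ξ, ‖ξ‖ ^ 2 ∂Λ) (hC₄ : C₄ = ∫ ξ, ‖ξ‖ ^ 4 ∂Λ)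
    (hC₈ : C₈ = ∫ ξ, ‖ξ‖ ^ 8 ∂Λ) :
    (∀ α : ℝ, MMD H (P.map X) (P.map fun w => denoiser pY σ α (Y w)) ≤
      ((√(4 * α ^ 2 * C * C₂ + C₄) / √2 * σ ^ 2 : ℝ) : EReal)) ∧
    MMD H (P.map X) (P.map fun w => denoiser pY σ (1 / 2) (Y w)) ≤
      ((√(C ^ 2 * C₄ + C₈) / (4 * √2) * σ ^ 4 : ℝ) : EReal) := by
  have hXm := hpX.hasLaw.aemeasurable
  have hYm := hpY.hasLaw.aemeasurable
  have : IsProbabilityMeasure (P.map X) := Measure.isProbabilityMeasure_map hXm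
  have hs : Measurable (∇ fun z => Real.log (pY z)) := measurable_gradient _
  have hdm : ∀ α, Measurable (denoiser pY σ α) := fun α => by unfold denoiser; fun_prop
  have hν : ∀ α, IsProbabilityMeasure (P.map fun w => denoiser pY σ α (Y w)) := fun α =>
    Measure.isProbabilityMeasure_map ((hdm α).comp_aemeasurable hYm)
  have hC0 : 0 ≤ C := (integral_nonneg fun w => sq_nonneg _).trans hC
  have h20 : 0 ≤ C₂ := hC₂ ▸ integral_nonneg fun ξ => by positivity
  have h40 : 0 ≤ C₄ := hC₄ ▸ integral_nonneg fun ξ => by positivity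
  have h80 : 0 ≤ C₈ := hC₈ ▸ integral_nonneg fun ξ => by positivity
  have hest := norm_charFun_sub_charFun_denoiser_le hσ hε hind hY hpX hgradX hpY hpYc hint hC
  -- Squaring the sum of two errors costs a factor `2`. It yields `σ⁴/2` and `2α²σ⁴C` in the first
  -- bound and `σ⁸/32` twice in the second, hence the `√2` and `4√2` in the constants.
  have hsq : ∀ {a x y : ℝ}, 0 ≤ a → a ≤ x + y → a ^ 2 ≤ 2 * x ^ 2 + 2 * y ^ 2 := fun {a x y} ha h =>
    (pow_le_pow_left₀ ha h 2).trans (by nlinarith [sq_nonneg (x - y)])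
  refine ⟨fun α => ?_, ?_⟩
  · have := hν α
    refine MMD_le_of_integral_charFun_le hψ hΛ _ _ (by positivity) ?_
    calc _ ≤ ∫ ξ, (2 * α ^ 2 * σ ^ 4 * C * ‖ξ‖ ^ 2 + σ ^ 4 / 2 * ‖ξ‖ ^ 4) ∂Λ := by
          refine integral_mono_of_nonneg (.of_forall fun ξ => sq_nonneg _)
            ((h2.const_mul _).add (h4.const_mul _)) (.of_forall fun ξ => ?_)
          refine (hsq (norm_nonneg _) ((hest ξ).1 α)).trans_eq ?_
          rw [mul_pow, mul_pow, sq_abs, Real.sq_sqrt hC0]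
          ring
      _ = 2 * α ^ 2 * σ ^ 4 * C * C₂ + σ ^ 4 / 2 * C₄ := by
          rw [integral_add (h2.const_mul _) (h4.const_mul _), integral_const_mul,
            integral_const_mul, hC₂, hC₄]
      _ = _ := by
          rw [mul_pow, div_pow, Real.sq_sqrt (by positivity), Real.sq_sqrt zero_le_two]
          ring
  · have := hν (1 / 2)
    refine MMD_le_of_integral_charFun_le hψ hΛ _ _ (by positivity) ?_
    calc _ ≤ ∫ ξ, (σ ^ 8 / 32 * ‖ξ‖ ^ 8 + σ ^ 8 / 32 * C ^ 2 * ‖ξ‖ ^ 4) ∂Λ := by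
          refine integral_mono_of_nonneg (.of_forall fun ξ => sq_nonneg _)
            ((h8.const_mul _).add (h4.const_mul _)) (.of_forall fun ξ => ?_)
          refine (hsq (norm_nonneg _) (hest ξ).2).trans_eq ?_
          ring
      _ = σ ^ 8 / 32 * C₈ + σ ^ 8 / 32 * C ^ 2 * C₄ := by
          rw [integral_add (h8.const_mul _) (h4.const_mul _), integral_const_mul,
            integral_const_mul, hC₈, hC₄]
      _ = _ := by
          rw [mul_pow, div_pow, mul_pow, Real.sq_sqrt (by positivity), Real.sq_sqrt zero_le_two]
          ring
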